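/- Let $q$ be a prime power, $m\ge 1$, $V$ a vector space of dimension $2m$ over $\mathbb F_q$, and $Q$ a nondegenerate quadratic form on $V$ of type $+1$ (hyperbolic, i.e. of Witt index $m$). Let $VO^+(2m,q)$ be the graph with vertex set $V$ in which distinct $x,y$ are adjacent if and only if $Q(x-y)=0$, and let $\theta_1$ be its second largest distinct eigenvalue. A pair of isolated cliques is an unordered pair $\{T_0,T_1\}$ of disjoint cliques with no edge between $T_0$ and $T_1$. A singular subspace is a subspace of $V$ on which $Q$ vanishes identically, identified with its set of projective points (one-dimensional subspaces); its dimension is the projective one, so the zero subspace has dimension $-1$. For a set $P$ of projective points let $A^*(P)$ be the set of nonzero vectors lying on some point of $P$. For a singular subspace $L$ let $\Sigma_L$ be the set of singular subspaces of dimension $m-1$ properly containing $L$, and let $$V\Delta_L=\bigl\{\{A^*(M\setminus L),A^*(N\setminus L)\} : M,N\in\Sigma_L,\ M\ne N\bigr\}.$$ For $v\in V$ put $v+V\Delta_L=\{\{v+T_0,v+T_1\}:\{T_0,T_1\}\in V\Delta_L\}$. Then the pairs $\{T_0,T_1\}$ of isolated cliques in $VO^+(2m,q)$ with $|T_0|=|T_1|=\theta_1+1$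 are exactly the members of the sets $v+V\Delta_L$, where $v$ ranges over $V$ and $L$ over the singular subspaces of dimension $m-2$. If $q\neq 2$, the number of these pairs is exactly $$q^{m+1}\cdot\frac{q^{m}-1}{q-1}\cdot\prod_{i=0}^{m-2}\bigl(q^{m-i-1}+1\bigr),$$ and if $q=2$ it is exactly half of this expression, namely $2^{m}(2^{m}-1)\prod_{i=0}^{m-2}(2^{m-i-1}+1)$. -/

import Mathlib

open scoped LinearAlgebra.Projectivization

noncomputable section

namespace AffinePolar

section Graphs

variable {V : Type*}

/-- `θ` is an eigenvalue of (the real adjacency matrix of) the finite graph `G`. -/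
def IsEigenvalue [Fintype V] (G : SimpleGraph V) (θ : ℝ) : Prop :=
  letI := Classical.decEq V
  letI := Classical.decRel G.Adj
  Module.End.HasEigenvalue (Matrix.toLin' (G.adjMatrix ℝ)) θ

/-- The second largest distinct eigenvalue of `G`: the largest among those eigenvalues that are
exceeded by another eigenvalue. For a connected strongly regular graph with eigenvalues
`k > θ₁ > θ₂` this is `θ₁`. -/
def theta1 [Fintype V] (G : SimpleGraph V) : ℝ :=
  sSup {θ : ℝ | IsEigenvalue G θ ∧ ∃ κ : ℝ, IsEigenvalue G κ ∧ θ < κ}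

/-- `T₀`, `T₁` are isolated cliques: they are disjoint cliques with no edge between them, that is,
the graph induced on `T₀ ∪ T₁` is the disjoint union of the complete graphs on `T₀` and `T₁`. -/
structure IsIsolatedPair (G : SimpleGraph V) (T₀ T₁ : Set V) : Prop where
  clique_left : G.IsClique T₀
  clique_right : G.IsClique T₁
  disjoint : Disjoint T₀ T₁
  not_adj : ∀ x ∈ T₀, ∀ y ∈ T₁, ¬ G.Adj x y

/-- The set of unordered pairs `{T₀, T₁}` of isolated cliques, both of size `s`. -/
def isolatedPairs (G : SimpleGraph V) (s : ℝ) : Set (Sym2 (Set V)) :=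
  {p | ∃ T₀ T₁ : Set V, p = s(T₀, T₁) ∧ IsIsolatedPair G T₀ T₁ ∧
    (T₀.ncard : ℝ) = s ∧ (T₁.ncard : ℝ) = s}

end Graphs

section Forms

variable {K V : Type*} [Field K] [AddCommGroup V] [Module K V]

/-- A subspace on which `Q` vanishes identically, i.e. a singular subspace of the polar space
of `Q`. -/
def IsSingular (Q : QuadraticForm K V) (W : Submodule K V) : Prop :=
  ∀ w ∈ W, Q w = 0

/-- `Q` is a nondegenerate quadratic form of type `+1` (hyperbolic) on a space of
dimension `2 * m`: its Witt index is `m`, the largest possible value. -/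
structure IsHyperbolic (Q : QuadraticForm K V) (m : ℕ) : Prop where
  finrank_eq : Module.finrank K V = 2 * m
  nondegenerate : Q.Nondegenerate
  exists_singular : ∃ W : Submodule K V, IsSingular Q W ∧ Module.finrank K W = m

/-- The affine polar graph of `Q`: distinct vectors `x`, `y` are adjacent when `Q (x - y) = 0`. -/
def affinePolarGraph (Q : QuadraticForm K V) : SimpleGraph V where
  Adj x y := x ≠ y ∧ Q (x - y) = 0
  symm := ⟨fun x y h => ⟨h.1.symm, by rw [← neg_sub, QuadraticMap.map_neg]; exact h.2⟩⟩
  loopless := ⟨fun _ h => h.1 rfl⟩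

/-- Projective dimension of a subspace (the zero subspace has dimension `-1`). -/
def projDim (W : Submodule K V) : ℤ := (Module.finrank K W : ℤ) - 1

/-- The set of projective points contained in a subspace. -/
def points (W : Submodule K V) : Set (ℙ K V) := {p | p.submodule ≤ W}

/-- The set of nonzero vectors lying on some point of a set `P` of projective points. -/
def affStar (P : Set (ℙ K V)) : Set V := {v | v ≠ 0 ∧ ∃ p ∈ P, v ∈ p.submodule}

/-- For the polar space of `Q`, of rank `n`: the set `Σ_L` of the singular subspaces of projective
dimension `n - 1` that properly contain `L`. -/
def sigma (Q : QuadraticForm K V) (n : ℕ) (L : Submodule K V) : Set (Submodule K V) :=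
  {M | IsSingular Q M ∧ L < M ∧ projDim M = (n : ℤ) - 1}

/-- `VΔ_L`: the unordered pairs formed by the nonzero vectors on the points of `M \ L` and the
nonzero vectors on the points of `N \ L`, for distinct `M`, `N` in `Σ_L`. -/
def vDelta (Q : QuadraticForm K V) (n : ℕ) (L : Submodule K V) : Set (Sym2 (Set V)) :=
  {p | ∃ M ∈ sigma Q n L, ∃ N ∈ sigma Q n L, M ≠ N ∧
    p = s(affStar (points M \ points L), affStar (points N \ points L))}

/-- The translate `v + VΔ_L`: every pair `{A, B}` of `VΔ_L` is replaced by `{v + A, v + B}`. -/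
def vDeltaTranslate (Q : QuadraticForm K V) (n : ℕ) (v : V) (L : Submodule K V) :
    Set (Sym2 (Set V)) :=
  Sym2.map (fun T : Set V => (fun x => v + x) '' T) '' vDelta Q n L

end Forms

end AffinePolar

end

/-! The graph is a Cayley graph on `V`, so everything reduces to counting singular vectors. The
number of ways to write `u` as a sum of two singular vectors depends only on whether `u` is zero,
nonzero singular, or nonsingular. Hence `A + I` satisfies a quadratic equation on functions of sum
zero, with roots `q^m - q^(m-1)` and `-q^(m-1)`. The first is attained, so the cliques in question
have `q^m - q^(m-1)` vertices (`IsHyperbolic.theta1_eq`).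

A clique lies in a coset `a + M` of a maximal singular subspace, and a vector outside that coset is
nonadjacent to exactly `q^m - q^(m-1)` of its members. So each vector of one clique determines the
other clique completely. If the two cosets `a + M` and `b + N` share a vector `v`, then, seen from
`v`, nonadjacency is nonvanishing of the polar form between `M` and `N`, and `M = M^⊥`, `N = N^⊥`
force the cliques to be the translates by `v` of `M \ N` and `N \ M`. If the cosets are disjoint,
then `q = 2`, and the cliques are cosets of one common subspace that again arise from an adjacent
pair, with a different base point (`IsHyperbolic.exists_adjacentPair`).

For the number, `L^⊥ / L` is a hyperbolic plane, so each `L` of vector dimension `m - 1` lies in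
exactly two maximal singular subspaces, and a pair is given by some `(L, v)`. It determines `L`, and
determines `v` modulo `L` if `q ≠ 2`. If `q = 2`, there is one further coincidence, which swaps the
two cliques and halves the count (`IsHyperbolic.ncard_isolatedPairs_mul`). The subspaces `L` are
counted through their ordered bases (`IsHyperbolic.card_singularSubspaces`). -/

noncomputable section

namespace AffinePolar

open QuadraticMap Module

/-! ### Orthogonality and singular subspaces of a hyperbolic form, in any characteristic. -/

section LinearAlgebra

variable {K V : Type*} [Field K] [AddCommGroup V] [Module K V] {Q : QuadraticForm K V}

/-- The orthogonal complement of a subspace with respect to the polar form of `Q`. -/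
def perp (Q : QuadraticForm K V) (W : Submodule K V) : Submodule K V :=
  LinearMap.BilinForm.orthogonal Q.polarBilin W

theorem mem_perp {W : Submodule K V} {x : V} : x ∈ perp Q W ↔ ∀ w ∈ W, polar Q w x = 0 :=
  LinearMap.BilinForm.mem_orthogonal_iff

theorem mem_perp' {W : Submodule K V} {x : V} : x ∈ perp Q W ↔ ∀ w ∈ W, polar Q x w = 0 := by
  simp only [mem_perp, polar_comm Q x]

theorem polarBilin_isRefl : LinearMap.BilinForm.IsRefl Q.polarBilin := by
  intro x y h
  simpa [polar_comm Q y x] using h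

theorem map_add_eq (x y : V) : Q (x + y) = Q x + Q y + polar Q x y := by
  simp [polar]

theorem map_sub_eq (x y : V) : Q (x - y) = Q x + Q y - polar Q x y := by
  rw [sub_eq_add_neg, map_add_eq, QuadraticMap.map_neg, polar_neg_right]; ring

theorem perp_anti {U W : Submodule K V} (h : U ≤ W) : perp Q W ≤ perp Q U :=
  LinearMap.BilinForm.orthogonal_le h

theorem IsSingular.mono {U W : Submodule K V} (hW : IsSingular Q W) (h : U ≤ W) :
    IsSingular Q U := fun x hx => hW x (h hx)

theorem IsSingular.polar_eq_zero {W : Submodule K V} (hW : IsSingular Q W) {x y : V}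
    (hx : x ∈ W) (hy : y ∈ W) : polar Q x y = 0 := by
  simp [polar, hW _ (W.add_mem hx hy), hW _ hx, hW _ hy]

theorem IsSingular.le_perp {W : Submodule K V} (hW : IsSingular Q W) : W ≤ perp Q W :=
  fun _ hx => mem_perp.2 fun _ hw => hW.polar_eq_zero hw hx

theorem IsSingular.sup {U W : Submodule K V} (hU : IsSingular Q U) (hW : IsSingular Q W)
    (h : U ≤ perp Q W) : IsSingular Q (U ⊔ W) := by
  intro x hx
  obtain ⟨u, hu, w, hw, rfl⟩ := Submodule.mem_sup.1 hx
  rw [map_add_eq, hU u hu, hW w hw, mem_perp'.1 (h hu) w hw]; simp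

theorem isSingular_span_singleton {x : V} (hx : Q x = 0) :
    IsSingular Q (Submodule.span K {x}) := by
  intro w hw
  obtain ⟨c, rfl⟩ := Submodule.mem_span_singleton.1 hw
  simp [QuadraticMap.map_smul, hx]

theorem isSingular_bot : IsSingular Q ⊥ := by
  intro w hw
  rw [(Submodule.mem_bot K).1 hw, QuadraticMap.map_zero]

theorem mem_perp_span {s : Set V} {x : V} :
    x ∈ perp Q (Submodule.span K s) ↔ ∀ w ∈ s, polar Q x w = 0 := by
  rw [mem_perp']
  refine ⟨fun h w hw => h w (Submodule.subset_span hw), fun h w hw => ?_⟩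
  have : Submodule.span K s ≤ LinearMap.ker (Q.polarBilin x) :=
    Submodule.span_le.2 fun y hy => by simpa using h y hy
  simpa using this hw

theorem mem_perp_span_singleton {x y : V} :
    x ∈ perp Q (Submodule.span K {y}) ↔ polar Q x y = 0 := by
  simp [mem_perp_span]

/-- Pairwise orthogonal singular vectors span a singular subspace. -/
theorem isSingular_span {s : Set V} (h0 : ∀ x ∈ s, Q x = 0)
    (h : ∀ x ∈ s, ∀ y ∈ s, polar Q x y = 0) : IsSingular Q (Submodule.span K s) := by
  have hle : Submodule.span K s ≤ perp Q (Submodule.span K s) :=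
    Submodule.span_le.2 fun x hx => mem_perp_span.2 (h x hx)
  intro x hx
  induction hx using Submodule.span_induction with
  | mem x hx => exact h0 x hx
  | zero => exact QuadraticMap.map_zero Q
  | add x y hx hy ihx ihy =>
    rw [map_add_eq, ihx, ihy, mem_perp'.1 (hle hx) y hy]; simp
  | smul a x hx ih => rw [QuadraticMap.map_smul, ih, smul_zero]

theorem perp_sup (U W : Submodule K V) : perp Q (U ⊔ W) = perp Q U ⊓ perp Q W := by
  refine le_antisymm (le_inf (perp_anti le_sup_left) (perp_anti le_sup_right)) ?_
  rintro x ⟨hU, hW⟩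
  rw [mem_perp']
  intro y hy
  obtain ⟨u, hu, w, hw, rfl⟩ := Submodule.mem_sup.1 hy
  rw [polar_add_right, mem_perp'.1 hU u hu, mem_perp'.1 hW w hw, add_zero]

theorem exists_mem_polar_eq_one {W : Submodule K V} {x : V} (hx : x ∉ perp Q W) :
    ∃ w ∈ W, polar Q x w = 1 := by
  rw [mem_perp'] at hx
  push Not at hx
  obtain ⟨w, hw, h⟩ := hx
  refine ⟨(polar Q x w)⁻¹ • w, W.smul_mem _ hw, ?_⟩
  rw [polar_smul_right, smul_eq_mul, inv_mul_cancel₀ h]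

variable [FiniteDimensional K V] {m : ℕ}

/-- The hypothesis only says that the radical of `Q` vanishes, which in characteristic 2 is a priori
weaker than nondegeneracy of the polar form. The radical of the polar form meets a singular `W` of
dimension `m` trivially, so the dimension formula gives `W^⊥ = W`. That radical lies in `W^⊥ = W`,
hence is zero. -/
theorem IsHyperbolic.polarBilin_orthogonal_top (hQ : IsHyperbolic Q m) :
    LinearMap.BilinForm.orthogonal Q.polarBilin ⊤ = ⊥ := by
  obtain ⟨W, hW, hWm⟩ := hQ.exists_singular
  have key := LinearMap.BilinForm.finrank_add_finrank_orthogonal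
    (polarBilin_isRefl (Q := Q)) W
  have hdis : ∀ x ∈ LinearMap.BilinForm.orthogonal Q.polarBilin ⊤, Q x = 0 → x = 0 := by
    intro x hx h0
    have hr : x ∈ Q.radical := by
      rw [QuadraticMap.mem_radical_iff']
      refine ⟨h0, fun y => ?_⟩
      have := (mem_perp (Q := Q)).1 hx y trivial
      rw [polar, h0] at this
      rw [add_comm]
      linear_combination this
    rwa [hQ.nondegenerate.radical_eq_bot, Submodule.mem_bot] at hr
  have h1 : W ⊓ LinearMap.BilinForm.orthogonal Q.polarBilin ⊤ = ⊥ := by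
    rw [eq_bot_iff]
    rintro x ⟨hx, hx'⟩
    exact hdis x hx' (hW x hx)
  rw [h1, finrank_bot, hQ.finrank_eq, hWm] at key
  have h2 : W = perp Q W := Submodule.eq_of_le_of_finrank_le hW.le_perp (by
    change finrank K (perp Q W) ≤ _
    have : finrank K (perp Q W) = m := by unfold perp; omega
    omega)
  rw [eq_bot_iff]
  intro x hx
  have : x ∈ W := by rw [h2]; exact perp_anti (Q := Q) le_top hx
  exact hdis x hx (hW x this)

theorem IsHyperbolic.finrank_add_finrank_perp (hQ : IsHyperbolic Q m) (W : Submodule K V) :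
    finrank K W + finrank K (perp Q W) = 2 * m := by
  have key := LinearMap.BilinForm.finrank_add_finrank_orthogonal
    (polarBilin_isRefl (Q := Q)) W
  rw [hQ.polarBilin_orthogonal_top, inf_bot_eq, finrank_bot, hQ.finrank_eq] at key
  exact key

theorem IsHyperbolic.perp_perp (hQ : IsHyperbolic Q m) (W : Submodule K V) :
    perp Q (perp Q W) = W := by
  refine (Submodule.eq_of_le_of_finrank_le
    (LinearMap.BilinForm.le_orthogonal_orthogonal polarBilin_isRefl) ?_).symm
  have h1 := hQ.finrank_add_finrank_perp W
  have h2 := hQ.finrank_add_finrank_perp (perp Q W)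
  change finrank K (perp Q (perp Q W)) ≤ _
  omega

theorem IsHyperbolic.perp_eq_self (hQ : IsHyperbolic Q m) {W : Submodule K V}
    (hW : IsSingular Q W) (hWm : finrank K W = m) : perp Q W = W := by
  have h1 := hQ.finrank_add_finrank_perp W
  exact (Submodule.eq_of_le_of_finrank_le hW.le_perp (by omega)).symm

theorem IsHyperbolic.finrank_le (hQ : IsHyperbolic Q m) {W : Submodule K V}
    (hW : IsSingular Q W) : finrank K W ≤ m := by
  have h1 := hQ.finrank_add_finrank_perp W
  have h2 := Submodule.finrank_mono hW.le_perp
  omega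

/-- Every singular subspace lies in one of the largest possible dimension. -/
theorem IsHyperbolic.exists_le_singular (hQ : IsHyperbolic Q m) {U : Submodule K V}
    (hU : IsSingular Q U) : ∃ W, U ≤ W ∧ IsSingular Q W ∧ finrank K W = m := by
  obtain ⟨W, hW, hWm⟩ := hQ.exists_singular
  -- The witness is `U + (W ∩ U^⊥)`. It is large enough because `W ∩ U^⊥ = (W + U)^⊥` has dimension
  -- `m - dim U + dim (W ∩ U)`.
  have hsing : IsSingular Q (U ⊔ W ⊓ perp Q U) := by
    refine hU.sup (hW.mono inf_le_left) ?_
    calc U = perp Q (perp Q U) := (hQ.perp_perp U).symm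
      _ ≤ perp Q (W ⊓ perp Q U) := perp_anti inf_le_right
  refine ⟨U ⊔ W ⊓ perp Q U, le_sup_left, hsing, le_antisymm (hQ.finrank_le hsing) ?_⟩
  have h1 : W ⊓ perp Q U = perp Q (W ⊔ U) := by rw [perp_sup, hQ.perp_eq_self hW hWm]
  have h2 := hQ.finrank_add_finrank_perp (W ⊔ U)
  have h3 := Submodule.finrank_sup_add_finrank_inf_eq W U
  have h4 := Submodule.finrank_sup_add_finrank_inf_eq U (W ⊓ perp Q U)
  have h5 : finrank K (U ⊓ (W ⊓ perp Q U) : Submodule K V) ≤ finrank K (W ⊓ U : Submodule K V) :=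
    Submodule.finrank_mono (le_inf (inf_le_right.trans inf_le_left) inf_le_left)
  rw [← h1] at h2
  omega

/-- The two maximal singular subspaces through a singular subspace `L` of dimension `m - 1` are
`L + ⟨e⟩` and `L + ⟨f⟩` for a hyperbolic pair `e`, `f`. -/
theorem IsHyperbolic.exists_hyperbolic_pair (hQ : IsHyperbolic Q m) {L : Submodule K V}
    (hL : IsSingular Q L) (hLm : finrank K L + 1 = m) :
    ∃ e f : V, Q e = 0 ∧ Q f = 0 ∧ polar Q e f = 1 ∧ e ∈ perp Q L ∧ f ∈ perp Q L ∧
      ∀ x, x ∈ perp Q L ↔ ∃ l ∈ L, ∃ a b : K, x = l + a • e + b • f := by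
  obtain ⟨W, hLW, hW, hWm⟩ := hQ.exists_le_singular hL
  have hP := hQ.finrank_add_finrank_perp L
  have hWP : W ≤ perp Q L := hW.le_perp.trans (perp_anti hLW)
  -- Since `W = W^⊥`, a vector `x` of `L^⊥` outside `W` pairs to 1 with some `e` in `W`. Subtracting
  -- `Q x • e` makes it singular without changing this pairing.
  obtain ⟨x, hxP, hxW⟩ : ∃ x ∈ perp Q L, x ∉ W := by
    by_contra! h
    have := Submodule.finrank_mono (show perp Q L ≤ W from h)
    omega
  rw [← hQ.perp_eq_self hW hWm] at hxW
  obtain ⟨e, heW, he⟩ := exists_mem_polar_eq_one hxW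
  have heP := hWP heW
  have hfP : x - Q x • e ∈ perp Q L := Submodule.sub_mem _ hxP (Submodule.smul_mem _ _ heP)
  have hef : polar Q e (x - Q x • e) = 1 := by
    rw [polar_sub_right, polar_smul_right, hW.polar_eq_zero heW heW, polar_comm, he]; simp
  have hf : Q (x - Q x • e) = 0 := by
    rw [map_sub_eq, QuadraticMap.map_smul, hW e heW, polar_smul_right, he]; simp
  refine ⟨e, x - Q x • e, hW e heW, hf, hef, heP, hfP, fun y => ?_⟩
  set f := x - Q x • e
  constructor
  swap
  · rintro ⟨l, hl, a, b, rfl⟩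
    exact add_mem (add_mem (hL.le_perp hl) (Submodule.smul_mem _ _ heP))
      (Submodule.smul_mem _ _ hfP)
  intro hy
  have hle : L ⊔ Submodule.span K {e, f} ≤ perp Q L := by
    refine sup_le hL.le_perp (Submodule.span_le.2 ?_)
    rintro z (rfl | rfl) <;> assumption
  have hdis : L ⊓ Submodule.span K {e, f} = ⊥ := by
    rw [eq_bot_iff]
    rintro z ⟨hz, hz'⟩
    obtain ⟨a, b, rfl⟩ := Submodule.mem_span_pair.1 hz'
    have h1 := mem_perp.1 heP _ hz
    have h2 := mem_perp.1 hfP _ hz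
    have h3 : polar Q f f = 0 := by rw [polar_self, hf, smul_zero]
    rw [polar_add_left, polar_smul_left, polar_smul_left, hW.polar_eq_zero heW heW,
      polar_comm Q f e, hef] at h1
    rw [polar_add_left, polar_smul_left, polar_smul_left, hef, h3] at h2
    simp only [smul_eq_mul, mul_zero, mul_one, zero_add, add_zero] at h1 h2
    simp [h1, h2]
  have hspan : finrank K (Submodule.span K {e, f}) = 2 := by
    have hli : LinearIndependent K ![e, f] := by
      rw [LinearIndependent.pair_iff]
      intro a b hab
      have h1 : polar Q (a • e + b • f) e = 0 := by rw [hab, polar_zero_left]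
      have h2 : polar Q (a • e + b • f) f = 0 := by rw [hab, polar_zero_left]
      have h3 : polar Q f f = 0 := by rw [polar_self, hf, smul_zero]
      rw [polar_add_left, polar_smul_left, polar_smul_left, hW.polar_eq_zero heW heW,
        polar_comm Q f e, hef] at h1
      rw [polar_add_left, polar_smul_left, polar_smul_left, hef, h3] at h2
      simp only [smul_eq_mul, mul_zero, mul_one, zero_add, add_zero] at h1 h2
      exact ⟨h2, h1⟩
    have := finrank_span_eq_card hli
    rwa [Matrix.range_cons, Matrix.range_cons, Matrix.range_empty, Set.union_empty,
      Fintype.card_fin, Set.singleton_union] at this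
  have hdim := Submodule.finrank_sup_add_finrank_inf_eq L (Submodule.span K {e, f})
  rw [hdis, finrank_bot, hspan] at hdim
  -- Both sides have dimension `m + 1`.
  have heq := Submodule.eq_of_le_of_finrank_le hle (by omega)
  rw [← heq] at hy
  obtain ⟨l, hl, z, hz, rfl⟩ := Submodule.mem_sup.1 hy
  obtain ⟨a, b, rfl⟩ := Submodule.mem_span_pair.1 hz
  exact ⟨l, hl, a, b, by abel⟩

end LinearAlgebra

/-! ### Counting singular vectors. -/

section Counting

open scoped Classical
open Finset (univ)

variable {K V : Type*} [Field K] [AddCommGroup V] [Module K V] [Fintype V]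
  {Q : QuadraticForm K V} {m : ℕ}

theorem card_singular_split (R X : Submodule K V) :
    (univ.filter fun x => x ∈ X ∧ Q x = 0).card =
      (univ.filter fun x => x ∈ X ⊓ perp Q R ∧ Q x = 0).card +
      (univ.filter fun x => x ∈ X ∧ x ∉ perp Q R ∧ Q x = 0).card := by
  rw [← Finset.card_filter_add_card_filter_not (s := univ.filter fun x => x ∈ X ∧ Q x = 0)
    (· ∈ perp Q R), Finset.filter_filter, Finset.filter_filter]
  congr 2 <;> ext x <;> simp only [Finset.mem_filter, Submodule.mem_inf] <;> tauto

variable [Fintype K]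

local notation "q" => Fintype.card K

theorem card_filter_mem (W : Submodule K V) :
    (univ.filter (· ∈ W)).card = q ^ finrank K W := by
  rw [← Module.card_eq_pow_finrank (K := K) (V := W), Fintype.card_subtype]

/-- Nonempty fibres of a functional on `W` all have the same size. -/
theorem card_fiber_mul (W : Submodule K V) (φ : V →ₗ[K] K) {w₀ : V} (hw₀ : w₀ ∈ W)
    (hφ : φ w₀ = 1) (c : K) :
    (univ.filter fun w => w ∈ W ∧ φ w = c).card * q = (univ.filter (· ∈ W)).card := by
  have h (d : K) : (univ.filter fun w => w ∈ W ∧ φ w = d).card =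
      (univ.filter fun w => w ∈ W ∧ φ w = c).card := by
    refine Finset.card_equiv (Equiv.addRight ((c - d) • w₀)) fun w => ?_
    have : w + (c - d) • w₀ ∈ W ↔ w ∈ W := W.add_mem_iff_left (W.smul_mem _ hw₀)
    simp only [Finset.mem_filter, Finset.mem_univ, true_and, Equiv.coe_addRight, this, map_add,
      map_smul, hφ, smul_eq_mul, mul_one]
    constructor
    · rintro ⟨h1, h2⟩
      exact ⟨h1, by rw [h2]; ring⟩
    · rintro ⟨h1, h2⟩
      exact ⟨h1, by linear_combination h2⟩
  rw [Finset.card_eq_sum_card_fiberwise (s := univ.filter (· ∈ W)) (f := φ) (t := univ)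
    (fun _ _ => Finset.mem_univ _)]
  simp only [Finset.filter_filter, h, Finset.sum_const, Finset.card_univ, smul_eq_mul, mul_comm]

/-- In a coset `x + W` of a singular subspace `W` with `x` not orthogonal to `W`, a proportion
`1 / q` of the vectors is singular. -/
theorem IsSingular.card_coset {W : Submodule K V} (hW : IsSingular Q W) {x : V}
    (hx : x ∉ perp Q W) :
    (univ.filter fun w => w ∈ W ∧ Q (x + w) = 0).card * q = (univ.filter (· ∈ W)).card := by
  obtain ⟨w₀, hw₀, h1⟩ := exists_mem_polar_eq_one hx
  -- On `x + W` the form is affine, `Q (x + w) = Q x + polar Q x w`, so its zeros form one fibre of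
  -- a nonzero functional.
  rw [← card_fiber_mul W (Q.polarBilin x) hw₀ (by simpa using h1) (-Q x)]
  congr 2
  ext w
  simp only [Finset.mem_filter, Finset.mem_univ, true_and, polarBilin_apply_apply]
  refine and_congr_right fun hw => ?_
  rw [map_add_eq, hW w hw, add_zero, add_eq_zero_iff_neg_eq, eq_comm]

/-- Averaging over `R`: translation by `R` preserves `X \ R^⊥`, and each coset of `R` in this set is
singular in a proportion `1 / q`. The set of pairs `(w, x)` with `Q (x + w) = 0` is counted in both
orders. -/
theorem IsSingular.card_singular_not_mem_perp {R X : Submodule K V} (hR : IsSingular Q R)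
    (hRX : R ≤ X) :
    (univ.filter fun x => x ∈ X ∧ x ∉ perp Q R ∧ Q x = 0).card * q =
      (univ.filter fun x => x ∈ X ∧ x ∉ perp Q R).card := by
  set r := (univ.filter (· ∈ R)).card with hr
  have hr0 : 0 < r := Finset.card_pos.2 ⟨0, by simp⟩
  refine Nat.eq_of_mul_eq_mul_left hr0 ?_
  have h1 (w : V) (hw : w ∈ R) :
      (univ.filter fun x => (x ∈ X ∧ x ∉ perp Q R) ∧ Q (x + w) = 0).card =
      (univ.filter fun x => x ∈ X ∧ x ∉ perp Q R ∧ Q x = 0).card := by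
    refine Finset.card_equiv (Equiv.addRight w) fun x => ?_
    have h2 : x + w ∈ X ↔ x ∈ X := X.add_mem_iff_left (hRX hw)
    have h3 : x + w ∈ perp Q R ↔ x ∈ perp Q R := (perp Q R).add_mem_iff_left (hR.le_perp hw)
    simp [h2, h3, and_assoc]
  have h4 : r * (univ.filter fun x => x ∈ X ∧ x ∉ perp Q R ∧ Q x = 0).card =
      ∑ x ∈ univ.filter (fun x => x ∈ X ∧ x ∉ perp Q R),
        (univ.filter fun w => w ∈ R ∧ Q (x + w) = 0).card := by
    rw [hr, ← smul_eq_mul, ← Finset.sum_const,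
      ← Finset.sum_congr rfl fun w hw => h1 w (Finset.mem_filter.1 hw).2]
    have := Finset.sum_card_bipartiteAbove_eq_sum_card_bipartiteBelow
      (s := univ.filter (· ∈ R)) (t := univ.filter (fun x => x ∈ X ∧ x ∉ perp Q R))
      (fun w x => Q (x + w) = 0)
    simpa only [Finset.bipartiteAbove, Finset.bipartiteBelow, Finset.filter_filter] using this
  rw [← mul_assoc, h4, Finset.sum_mul,
    Finset.sum_congr rfl fun x hx => hR.card_coset (Finset.mem_filter.1 hx).2.2,
    Finset.sum_const, smul_eq_mul, mul_comm]

theorem card_not_mem (X Y : Submodule K V) :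
    (univ.filter fun x => x ∈ X ∧ x ∉ Y).card + q ^ finrank K (X ⊓ Y : Submodule K V) =
      q ^ finrank K X := by
  rw [← card_filter_mem X, ← card_filter_mem (X ⊓ Y), add_comm,
    ← Finset.card_filter_add_card_filter_not (s := univ.filter fun x => x ∈ X) (· ∈ Y),
    Finset.filter_filter, Finset.filter_filter]
  simp only [Submodule.mem_inf]

/-- The number of singular vectors of a space `X` containing the singular subspace `R`. -/
theorem IsSingular.card_singular {R X : Submodule K V} (hR : IsSingular Q R) (hRX : R ≤ X) :
    (univ.filter fun x => x ∈ X ∧ Q x = 0).card * q +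
      q ^ finrank K (X ⊓ perp Q R : Submodule K V) =
      (univ.filter fun x => x ∈ X ⊓ perp Q R ∧ Q x = 0).card * q + q ^ finrank K X := by
  rw [card_singular_split R X, add_mul, hR.card_singular_not_mem_perp hRX, add_assoc,
    card_not_mem]

/-- The number of singular vectors orthogonal to a singular subspace of dimension `k`. -/
theorem IsHyperbolic.card_singular_perp (hQ : IsHyperbolic Q m) {U : Submodule K V}
    (hU : IsSingular Q U) :
    (univ.filter fun x => x ∈ perp Q U ∧ Q x = 0).card * q + q ^ m =
      q ^ m * q + q ^ (2 * m - finrank K U) := by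
  obtain ⟨W, hUW, hW, hWm⟩ := hQ.exists_le_singular hU
  have hWP : W ≤ perp Q U := hW.le_perp.trans (perp_anti hUW)
  have key := hW.card_singular hWP
  have h1 : perp Q U ⊓ perp Q W = W := by
    rw [hQ.perp_eq_self hW hWm, inf_eq_right.2 hWP]
  have h2 : (univ.filter fun x => x ∈ W ∧ Q x = 0) = univ.filter (· ∈ W) := by
    ext x; simpa using hW x
  have h3 := hQ.finrank_add_finrank_perp U
  rw [h1, h2, card_filter_mem, hWm] at key
  rw [key, show 2 * m - finrank K U = finrank K (perp Q U) by omega]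

theorem IsHyperbolic.card_singular_all (hQ : IsHyperbolic Q m) :
    (univ.filter fun x => Q x = 0).card * q + q ^ m = q ^ m * q + q ^ (2 * m) := by
  have h := hQ.card_singular_perp (isSingular_bot (Q := Q))
  have h2 : perp Q ⊥ = ⊤ := LinearMap.BilinForm.orthogonal_bot
  simpa [h2] using h

/-- The number of singular vectors orthogonal to a nonsingular vector. -/
theorem IsHyperbolic.card_singular_perp_nonsingular (hQ : IsHyperbolic Q m) {u : V}
    (hu : Q u ≠ 0) :
    (univ.filter fun x => polar Q x u = 0 ∧ Q x = 0).card * q * q = q ^ (2 * m) := by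
  obtain ⟨W, hW, hWm⟩ := hQ.exists_singular
  have hWW := hQ.perp_eq_self hW hWm
  have huW : u ∉ W := fun h => hu (hW u h)
  have hu0 : u ≠ 0 := fun h => hu (by simp [h])
  set X := perp Q (Submodule.span K {u}) with hX
  have hXd : finrank K X + 1 = 2 * m := by
    have := hQ.finrank_add_finrank_perp (Submodule.span K {u})
    rw [finrank_span_singleton hu0, ← hX] at this
    omega
  -- With `X = u^⊥`, the space `X ∩ R^⊥` has dimension `m` and its only singular vectors are those
  -- of `R`, so `IsSingular.card_singular` gives the count.
  set R := W ⊓ X with hRdef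
  have hR : IsSingular Q R := hW.mono inf_le_left
  have hRp : R = perp Q (W ⊔ Submodule.span K {u}) := by rw [perp_sup, hWW]
  have hRP : perp Q R = W ⊔ Submodule.span K {u} := by rw [hRp, hQ.perp_perp]
  have hsd : finrank K (W ⊔ Submodule.span K {u} : Submodule K V) = m + 1 := by
    have h1 := Submodule.finrank_sup_add_finrank_inf_eq W (Submodule.span K {u})
    have h2 : W ⊓ Submodule.span K {u} = ⊥ := by
      rw [eq_bot_iff]
      rintro x ⟨hx, hx'⟩
      obtain ⟨c, rfl⟩ := Submodule.mem_span_singleton.1 hx'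
      by_contra hc
      have hc0 : c ≠ 0 := fun h => hc (by simp [h])
      exact huW ((W.smul_mem_iff hc0).1 hx)
    rw [h2, finrank_bot, finrank_span_singleton hu0, hWm] at h1
    omega
  have hRd : finrank K R + 1 = m := by
    have := hQ.finrank_add_finrank_perp (W ⊔ Submodule.span K {u})
    rw [← hRp] at this
    omega
  have hXR : finrank K (X ⊓ perp Q R : Submodule K V) = m := by
    have h1 : X ⊓ perp Q R = perp Q (Submodule.span K {u} ⊔ R) := by rw [perp_sup]
    have h2 := hQ.finrank_add_finrank_perp (Submodule.span K {u} ⊔ R)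
    have h3 := Submodule.finrank_sup_add_finrank_inf_eq (Submodule.span K {u}) R
    have h4 : Submodule.span K {u} ⊓ R = ⊥ := by
      rw [eq_bot_iff]
      rintro x ⟨hx', hx⟩
      obtain ⟨c, rfl⟩ := Submodule.mem_span_singleton.1 hx'
      by_contra hc
      have hc0 : c ≠ 0 := fun h => hc (by simp [h])
      exact huW ((W.smul_mem_iff hc0).1 hx.1)
    rw [h4, finrank_bot, finrank_span_singleton hu0] at h3
    rw [h1]
    omega
  have hsing : (univ.filter fun x => x ∈ X ⊓ perp Q R ∧ Q x = 0) = univ.filter (· ∈ R) := by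
    ext x
    simp only [Finset.mem_filter, Finset.mem_univ, true_and]
    constructor
    · rintro ⟨⟨hxX, hxP⟩, hx0⟩
      rw [hRP] at hxP
      obtain ⟨w, hw, y, hy, rfl⟩ := Submodule.mem_sup.1 hxP
      obtain ⟨c, rfl⟩ := Submodule.mem_span_singleton.1 hy
      have h1 := mem_perp_span_singleton.1 hxX
      rw [polar_add_left, polar_smul_left, polar_self] at h1
      rw [map_add_eq, hW w hw, QuadraticMap.map_smul, polar_smul_right] at hx0
      simp only [smul_eq_mul, nsmul_eq_mul, Nat.cast_ofNat] at h1 hx0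
      -- Since `polar Q u u = 2 * Q u`, the combination leaves `c² Q u` with coefficient 1, so
      -- characteristic 2 needs no separate treatment.
      have h3 : c * c * Q u = 0 := by linear_combination c * h1 - hx0
      have hc : c = 0 := by simpa [hu] using h3
      subst hc
      rw [zero_smul, add_zero] at hxX ⊢
      exact ⟨hw, hxX⟩
    · intro hx
      exact ⟨⟨hx.2, hR.le_perp hx⟩, hR x hx⟩
  have key := hR.card_singular (X := X) inf_le_right
  rw [hsing, card_filter_mem, hXR, ← pow_succ, hRd] at key
  have h5 : (univ.filter fun x => polar Q x u = 0 ∧ Q x = 0) =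
      univ.filter fun x => x ∈ X ∧ Q x = 0 := by
    simp only [hX, mem_perp_span_singleton]
  rw [h5, ← hXd, pow_succ]
  congr 1
  omega

/-- The number of ways to write a nonsingular vector as a sum of two singular ones. -/
theorem IsHyperbolic.card_singular_sub_nonsingular (hQ : IsHyperbolic Q m) (hm : 1 ≤ m) {u : V}
    (hu : Q u ≠ 0) :
    (univ.filter fun x => Q x = 0 ∧ Q (u - x) = 0).card = q ^ (2 * m - 2) + q ^ (m - 1) := by
  have hcong : (univ.filter fun x => Q x = 0 ∧ Q (u - x) = 0) =
      univ.filter fun x => polar Q x u = Q u ∧ Q x = 0 := by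
    ext x
    simp only [Finset.mem_filter, Finset.mem_univ, true_and]
    rw [map_sub_eq, polar_comm]
    constructor
    · rintro ⟨h1, h2⟩
      exact ⟨by linear_combination h1 - h2, h1⟩
    · rintro ⟨h1, h2⟩
      exact ⟨h2, by linear_combination h2 - h1⟩
  rw [hcong]
  -- Scaling preserves singularity and permutes the nonzero values of `polar Q x u`. The wanted
  -- fibre therefore holds `1 / (q - 1)` of the singular vectors not orthogonal to `u`.
  have hfib (a : K) (ha : a ≠ 0) : (univ.filter fun x => polar Q x u = a ∧ Q x = 0).card =
      (univ.filter fun x => polar Q x u = Q u ∧ Q x = 0).card := by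
    refine Finset.card_equiv (MulAction.toPerm (Units.mk0 (Q u / a) (div_ne_zero hu ha)))
      fun x => ?_
    simp only [Finset.mem_filter, Finset.mem_univ, true_and, MulAction.toPerm_apply,
      Units.smul_mk0, polar_smul_left, QuadraticMap.map_smul, smul_eq_mul, mul_eq_zero,
      div_eq_zero_iff, hu, ha, or_self, false_or]
    refine and_congr_left fun _ => ?_
    rw [div_mul_eq_mul_div, div_eq_iff ha, mul_right_inj' hu]
  have htot : (univ.filter fun x => Q x = 0).card =
      (univ.filter fun x => polar Q x u = 0 ∧ Q x = 0).card +
        (q - 1) * (univ.filter fun x => polar Q x u = Q u ∧ Q x = 0).card := by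
    rw [Finset.card_eq_sum_card_fiberwise (f := fun x => polar Q x u) (t := univ)
      (fun _ _ => Finset.mem_univ _),
      ← Finset.add_sum_erase _ _ (Finset.mem_univ (0 : K))]
    simp only [Finset.filter_filter, and_comm (a := Q _ = 0)]
    rw [Finset.sum_congr rfl fun a ha => hfib a (Finset.ne_of_mem_erase ha), Finset.sum_const,
      Finset.card_erase_of_mem (Finset.mem_univ _), Finset.card_univ, smul_eq_mul]
  have h1 := hQ.card_singular_all
  have h2 := hQ.card_singular_perp_nonsingular hu
  obtain ⟨k, rfl⟩ : ∃ k, m = k + 1 := ⟨m - 1, by omega⟩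
  have hq1 : 1 < q := Fintype.one_lt_card
  obtain ⟨r, hr⟩ : ∃ r, q = r + 2 := ⟨q - 2, by omega⟩
  rw [htot] at h1
  simp only [hr] at h1 h2 ⊢
  set A := (univ.filter fun x => polar Q x u = 0 ∧ Q x = 0).card
  set N := (univ.filter fun x => polar Q x u = Q u ∧ Q x = 0).card
  have e1 : 2 * (k + 1) - 2 = 2 * k := by omega
  have e2 : r + 2 - 1 = r + 1 := by omega
  rw [e1, Nat.add_sub_cancel]
  rw [e2] at h1
  have hA : A = (r + 2) ^ (2 * k) := by
    have : A * ((r + 2) * (r + 2)) = (r + 2) ^ (2 * k) * ((r + 2) * (r + 2)) := by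
      rw [← mul_assoc, h2]; ring
    exact Nat.eq_of_mul_eq_mul_right (by positivity) this
  rw [hA] at h1
  have : ((r + 1) * (r + 2)) * N = ((r + 1) * (r + 2)) * ((r + 2) ^ (2 * k) + (r + 2) ^ k) := by
    have h1' := congrArg (Nat.cast (R := ℤ)) h1
    zify
    push_cast at h1'
    linear_combination h1'
  exact Nat.eq_of_mul_eq_mul_left (by positivity) this

/-- The number of ways to write a nonzero singular vector as a sum of two singular ones. -/
theorem IsHyperbolic.card_singular_sub_singular (hQ : IsHyperbolic Q m) {u : V}
    (hu : Q u = 0) (hu0 : u ≠ 0) :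
    (univ.filter fun x => Q x = 0 ∧ Q (u - x) = 0).card * q + q ^ m =
      q ^ m * q + q ^ (2 * m - 1) := by
  have := hQ.card_singular_perp (isSingular_span_singleton hu)
  rw [finrank_span_singleton hu0] at this
  rw [← this]
  congr 3
  ext x
  simp only [Finset.mem_filter, Finset.mem_univ, true_and, mem_perp_span_singleton]
  rw [map_sub_eq, hu, polar_comm Q u x, and_comm]
  refine and_congr_left fun h => ?_
  rw [h, add_zero, zero_sub, neg_eq_zero]

end Counting

/-! ### The second largest eigenvalue of the affine polar graph. -/

section Spectrum

open scoped Classical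
open Finset (univ)

theorem isEigenvalue_iff {V : Type*} [Fintype V] {G : SimpleGraph V} {θ : ℝ} :
    IsEigenvalue G θ ↔ ∃ f : V → ℝ, f ≠ 0 ∧ ∀ x, (∑ y with G.Adj x y, f y) = θ * f x := by
  unfold IsEigenvalue
  constructor
  · intro h
    obtain ⟨f, hf⟩ := h.exists_hasEigenvector
    refine ⟨f, hf.2, fun x => ?_⟩
    have := congrFun hf.apply_eq_smul x
    rw [Matrix.toLin'_apply, SimpleGraph.adjMatrix_mulVec_apply] at this
    rw [Pi.smul_apply, smul_eq_mul] at this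
    rw [← this]
    refine Finset.sum_congr ?_ fun _ _ => rfl
    ext y; simp
  · rintro ⟨f, hf, h⟩
    refine Module.End.hasEigenvalue_of_hasEigenvector (x := f) ⟨?_, hf⟩
    rw [Module.End.mem_eigenspace_iff]
    ext x
    rw [Matrix.toLin'_apply, SimpleGraph.adjMatrix_mulVec_apply, Pi.smul_apply, smul_eq_mul, ← h]
    refine Finset.sum_congr ?_ fun _ _ => rfl
    ext y; simp

variable {K V : Type*} [Field K] [AddCommGroup V] [Module K V] [Fintype V]
  {Q : QuadraticForm K V} {m : ℕ}

/-- The sum of `f` over the closed neighbourhood of `x` in the affine polar graph. -/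
def singularSum (Q : QuadraticForm K V) (f : V → ℝ) (x : V) : ℝ :=
  ∑ s with Q s = 0, f (x + s)

theorem singularSum_eq (f : V → ℝ) (x : V) :
    singularSum Q f x = f x + ∑ y with (affinePolarGraph Q).Adj x y, f y := by
  have h : singularSum Q f x = ∑ y with Q (x - y) = 0, f y := by
    refine Finset.sum_equiv (Equiv.addLeft x) (fun s => ?_) fun s _ => rfl
    simp
  have h2 : (univ.filter fun y => Q (x - y) = 0) =
      insert x (univ.filter fun y => (affinePolarGraph Q).Adj x y) := by
    ext y
    simp only [Finset.mem_filter, Finset.mem_univ, true_and, Finset.mem_insert]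
    rw [show (affinePolarGraph Q).Adj x y ↔ x ≠ y ∧ Q (x - y) = 0 from Iff.rfl]
    by_cases hxy : x = y
    · subst hxy; simp
    · simp [hxy, Ne.symm hxy]
  rw [h, h2, Finset.sum_insert (by simp)]

theorem isEigenvalue_affinePolarGraph_iff {θ : ℝ} :
    IsEigenvalue (affinePolarGraph Q) θ ↔
      ∃ f : V → ℝ, f ≠ 0 ∧ ∀ x, singularSum Q f x = (θ + 1) * f x := by
  rw [isEigenvalue_iff]
  refine exists_congr fun f => and_congr_right fun _ => forall_congr' fun x => ?_
  rw [singularSum_eq]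
  constructor <;> intro h <;> linarith

theorem sum_singularSum (f : V → ℝ) :
    ∑ x, singularSum Q f x = (univ.filter fun s => Q s = 0).card * ∑ x, f x := by
  unfold singularSum
  rw [Finset.sum_comm, ← nsmul_eq_mul, ← Finset.sum_const]
  exact Finset.sum_congr rfl fun s _ => Equiv.sum_comp (Equiv.addRight s) f

/-- The square of `A + I` as a convolution: the coefficient at `u` counts representations of `u` as
a sum of two singular vectors. -/
theorem singularSum_singularSum (f : V → ℝ) (x : V) :
    singularSum Q (singularSum Q f) x =
      ∑ u, ((univ.filter fun s => Q s = 0 ∧ Q (u - s) = 0).card : ℝ) * f (x + u) := by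
  have h1 (s : V) : singularSum Q f (x + s) = ∑ u with Q (u - s) = 0, f (x + u) := by
    refine Finset.sum_equiv (Equiv.addLeft s) (fun t => by simp) fun t _ => ?_
    simp [add_assoc]
  have h2 : singularSum Q (singularSum Q f) x =
      ∑ s, ∑ u, if Q s = 0 ∧ Q (u - s) = 0 then f (x + u) else 0 := by
    rw [singularSum, Finset.sum_filter]
    refine Finset.sum_congr rfl fun s _ => ?_
    rw [h1, Finset.sum_filter]
    by_cases h : Q s = 0 <;> simp [h]
  rw [h2, Finset.sum_comm]
  refine Finset.sum_congr rfl fun u _ => ?_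
  rw [← Finset.sum_filter, Finset.sum_const, nsmul_eq_mul]

variable [Fintype K]
local notation "q" => Fintype.card K

/-- The coefficient takes three values, according to whether `u` is nonsingular, nonzero singular,
or zero. It is thus a constant plus a jump on singular vectors plus a jump at 0. The constant part
is annihilated by the sum-zero condition, leaving the quadratic equation of `A + I`. -/
theorem IsHyperbolic.singularSum_singularSum (hQ : IsHyperbolic Q m) (hm : 1 ≤ m) {f : V → ℝ}
    (hf : ∑ x, f x = 0) (x : V) :
    singularSum Q (singularSum Q f) x =
      ((q : ℝ) ^ m - 2 * (q : ℝ) ^ (m - 1)) * singularSum Q f x +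
        ((q : ℝ) ^ m - (q : ℝ) ^ (m - 1)) * (q : ℝ) ^ (m - 1) * f x := by
  obtain ⟨k, rfl⟩ : ∃ k, m = k + 1 := ⟨m - 1, by omega⟩
  have hq0 : (q : ℝ) ≠ 0 := by simp
  rw [Nat.add_sub_cancel, AffinePolar.singularSum_singularSum]
  have hc (u : V) : ((univ.filter fun s => Q s = 0 ∧ Q (u - s) = 0).card : ℝ) =
      ((q : ℝ) ^ (2 * k) + (q : ℝ) ^ k) +
      (if Q u = 0 then (q : ℝ) ^ (k + 1) - 2 * (q : ℝ) ^ k else 0) +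
      (if u = 0 then ((q : ℝ) ^ (k + 1) - (q : ℝ) ^ k) * (q : ℝ) ^ k else 0) := by
    by_cases hu : Q u = 0
    · rw [if_pos hu]
      by_cases hu0 : u = 0
      · rw [if_pos hu0]
        have := hQ.card_singular_all
        have e : (univ.filter fun s => Q s = 0 ∧ Q (u - s) = 0) =
            univ.filter fun s => Q s = 0 := by
          ext s; simp [hu0]
        rw [e]
        have := congrArg (Nat.cast (R := ℝ)) this
        push_cast at this
        refine mul_right_cancel₀ hq0 ?_
        linear_combination this
      · rw [if_neg hu0]
        have := congrArg (Nat.cast (R := ℝ)) (hQ.card_singular_sub_singular hu hu0)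
        rw [show 2 * (k + 1) - 1 = 2 * k + 1 by omega] at this
        push_cast at this
        refine mul_right_cancel₀ hq0 ?_
        linear_combination this
    · have hu0 : u ≠ 0 := fun h => hu (by simp [h])
      rw [if_neg hu, if_neg hu0, hQ.card_singular_sub_nonsingular hm hu]
      simp [show 2 * (k + 1) - 2 = 2 * k by omega]
  have hsum : ∑ u, f (x + u) = 0 := by
    rw [← hf]; exact Equiv.sum_comp (Equiv.addLeft x) f
  simp only [hc, add_mul, ite_mul, zero_mul, Finset.sum_add_distrib, Finset.sum_ite_eq',
    Finset.mem_univ, if_true, ← Finset.mul_sum, ← Finset.sum_filter]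
  rw [hsum, singularSum, add_zero]
  ring

/-- The neighbourhood sums of the indicator function of a coset of a maximal singular subspace. -/
theorem IsHyperbolic.singularSum_coset (hQ : IsHyperbolic Q m) {W : Submodule K V}
    (hm : 1 ≤ m) (hW : IsSingular Q W) (hWm : finrank K W = m) (a x : V) :
    singularSum Q (fun y => if y - a ∈ W then 1 else 0) x =
      (q : ℝ) ^ (m - 1) +
        ((q : ℝ) ^ m - (q : ℝ) ^ (m - 1)) * (if x - a ∈ W then 1 else 0) := by
  rw [singularSum, Finset.sum_ite, Finset.sum_const_zero, add_zero, Finset.sum_const,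
    nsmul_eq_mul, mul_one, Finset.filter_filter]
  split_ifs with h
  · have e : (univ.filter fun s => Q s = 0 ∧ x + s - a ∈ W) = univ.filter (· ∈ W) := by
      ext s
      have : x + s - a ∈ W ↔ s ∈ W := by
        rw [show x + s - a = (x - a) + s by abel]
        exact W.add_mem_iff_right h
      simp only [Finset.mem_filter, Finset.mem_univ, true_and, this]
      exact ⟨fun h => h.2, fun h => ⟨hW s h, h⟩⟩
    rw [e, card_filter_mem, hWm]
    push_cast; ring
  · have h' : a - x ∉ perp Q W := by
      rw [hQ.perp_eq_self hW hWm, ← neg_sub, W.neg_mem_iff]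
      exact h
    have key := hW.card_coset h'
    have e : (univ.filter fun s => Q s = 0 ∧ x + s - a ∈ W).card =
        (univ.filter fun w => w ∈ W ∧ Q (a - x + w) = 0).card := by
      refine Finset.card_equiv (Equiv.addLeft (x - a)) fun s => ?_
      simp only [Finset.mem_filter, Finset.mem_univ, true_and, Equiv.coe_addLeft]
      rw [show x + s - a = x - a + s by abel, show a - x + (x - a + s) = s by abel, and_comm]
    rw [e, mul_zero, add_zero]
    rw [card_filter_mem, hWm] at key
    have := congrArg (Nat.cast (R := ℝ)) key
    push_cast at this
    have hq0 : (q : ℝ) ≠ 0 := by simp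
    refine mul_right_cancel₀ hq0 ?_
    rw [this, ← pow_succ, Nat.sub_add_cancel hm]

/-- In the difference of the indicators of two cosets of a maximal singular subspace, the constant
terms of `singularSum_coset` cancel. -/
theorem IsHyperbolic.exists_singularSum_eq (hQ : IsHyperbolic Q m) (hm : 1 ≤ m) :
    ∃ f : V → ℝ, f ≠ 0 ∧ ∀ x, singularSum Q f x = ((q : ℝ) ^ m - (q : ℝ) ^ (m - 1)) * f x := by
  obtain ⟨W, hW, hWm⟩ := hQ.exists_singular
  obtain ⟨a, ha⟩ : ∃ a, a ∉ W := by
    by_contra! h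
    have : W = ⊤ := by rw [eq_top_iff]; exact fun x _ => h x
    have h2 := hQ.finrank_eq
    rw [← finrank_top, ← this] at h2
    omega
  refine ⟨fun y => (if y - 0 ∈ W then 1 else 0) - (if y - a ∈ W then 1 else 0), ?_, fun x => ?_⟩
  · intro h
    have := congrFun h 0
    simp [ha] at this
  · have h1 := hQ.singularSum_coset hm hW hWm 0 x
    have h2 := hQ.singularSum_coset hm hW hWm a x
    simp only [singularSum] at h1 h2 ⊢
    rw [Finset.sum_sub_distrib, h1, h2]
    ring

/-- Summing the eigenvalue equation over `V` shows that an eigenfunction has sum zero unless its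
eigenvalue is the valency `N - 1`. The quadratic equation then leaves two possible values, of which
the larger occurs. -/
theorem IsHyperbolic.theta1_eq (hQ : IsHyperbolic Q m) (hm : 1 ≤ m) :
    theta1 (affinePolarGraph Q) + 1 = (q : ℝ) ^ m - (q : ℝ) ^ (m - 1) := by
  set N := (univ.filter fun s => Q s = 0).card with hN
  have hq1 : (1 : ℝ) < q := by exact_mod_cast Fintype.one_lt_card
  have hlt : (q : ℝ) ^ m - (q : ℝ) ^ (m - 1) < N := by
    have h1 := congrArg (Nat.cast (R := ℝ)) hQ.card_singular_all
    push_cast at h1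
    rw [← hN] at h1
    have h2 : (q : ℝ) ^ m ≤ q ^ (2 * m) := pow_le_pow_right₀ hq1.le (by omega)
    have h3 : 0 < (q : ℝ) ^ (m - 1) := by positivity
    have h4 : (N : ℝ) * q ≥ q ^ m * q := by linarith
    have := le_of_mul_le_mul_right h4 (by linarith)
    linarith
  have hother {θ : ℝ} (h : IsEigenvalue (affinePolarGraph Q) θ) (hne : θ + 1 ≠ N) :
      θ + 1 ≤ (q : ℝ) ^ m - (q : ℝ) ^ (m - 1) := by
    obtain ⟨f, hf, hfe⟩ := isEigenvalue_affinePolarGraph_iff.1 h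
    have hsum : ∑ x, f x = 0 := by
      have h1 := sum_singularSum (Q := Q) f
      simp only [hfe, ← Finset.mul_sum] at h1
      have h2 : (θ + 1 - N) * ∑ x, f x = 0 := by rw [sub_mul, h1]; ring
      exact (mul_eq_zero.1 h2).resolve_left (sub_ne_zero.2 hne)
    obtain ⟨x, hx⟩ := Function.ne_iff.1 hf
    have key := hQ.singularSum_singularSum hm hsum x
    have e : singularSum Q (singularSum Q f) x = (θ + 1) * ((θ + 1) * f x) := by
      rw [← hfe, show singularSum Q f = fun y => (θ + 1) * f y from funext hfe]
      simp only [singularSum, ← Finset.mul_sum]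
      rw [← hfe x]; rfl
    rw [e, hfe] at key
    have h3 : (θ + 1 - ((q : ℝ) ^ m - (q : ℝ) ^ (m - 1))) * (θ + 1 + (q : ℝ) ^ (m - 1)) = 0 := by
      refine (mul_eq_zero.1 (?_ : _ * f x = 0)).resolve_right hx
      linear_combination key
    rcases mul_eq_zero.1 h3 with h4 | h4
    · linarith
    · have : 0 ≤ (q : ℝ) ^ m := by positivity
      linarith
  have hk : IsEigenvalue (affinePolarGraph Q) (N - 1) := by
    refine isEigenvalue_affinePolarGraph_iff.2 ⟨fun _ => 1, ?_, fun x => ?_⟩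
    · exact fun h => one_ne_zero (congrFun h (0 : V))
    · simp [singularSum, hN]
  have hgr : IsGreatest {θ : ℝ | IsEigenvalue (affinePolarGraph Q) θ ∧
      ∃ κ : ℝ, IsEigenvalue (affinePolarGraph Q) κ ∧ θ < κ}
      ((q : ℝ) ^ m - (q : ℝ) ^ (m - 1) - 1) := by
    refine ⟨⟨?_, N - 1, hk, by linarith⟩, ?_⟩
    · rw [isEigenvalue_affinePolarGraph_iff, sub_add_cancel]
      exact hQ.exists_singularSum_eq hm
    · rintro θ ⟨hθ, κ, hκ, hlt'⟩
      -- The valency does not belong to the set: no eigenvalue exceeds it.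
      by_cases hne : θ + 1 = N
      · have := hother hκ (by linarith)
        linarith
      · linarith [hother hθ hne]
  rw [theta1, hgr.csSup_eq, sub_add_cancel]

end Spectrum

/-! ### Pairs of maximal singular subspaces meeting in codimension one. -/

section Pairs

variable {K V : Type*} [Field K] [AddCommGroup V] [Module K V] {Q : QuadraticForm K V} {m : ℕ}

/-- The translate by `v` of the set difference of two subspaces. -/
def cosetDiff (v : V) (M L : Submodule K V) : Set V := {x | x - v ∈ M ∧ x - v ∉ L}

theorem mem_cosetDiff {v x : V} {M L : Submodule K V} :
    x ∈ cosetDiff v M L ↔ x - v ∈ M ∧ x - v ∉ L := Iff.rfl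

theorem affStar_points_diff (M L : Submodule K V) :
    affStar (points M \ points L) = {x | x ∈ M ∧ x ∉ L} := by
  ext x
  simp only [affStar, points, Set.mem_sdiff, Set.mem_ofPred_eq]
  constructor
  · rintro ⟨hx, p, ⟨hM, hL⟩, hp⟩
    refine ⟨hM hp, fun h => hL ?_⟩
    have : p.submodule = Submodule.span K {x} := by
      have h1 : p = Projectivization.mk K x hx := by
        rw [← Projectivization.submodule_injective.eq_iff, Projectivization.submodule_mk]
        refine (Submodule.eq_of_le_of_finrank_le
          ((Submodule.span_singleton_le_iff_mem _ _).2 hp) ?_).symm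
        rw [p.finrank_submodule, finrank_span_singleton hx]
      rw [h1, Projectivization.submodule_mk]
    rw [this, Submodule.span_singleton_le_iff_mem]
    exact h
  · rintro ⟨hM, hL⟩
    have hx : x ≠ 0 := fun h => hL (h ▸ L.zero_mem)
    refine ⟨hx, Projectivization.mk K x hx, ?_, ?_⟩
    · simp only [Projectivization.submodule_mk, Submodule.span_singleton_le_iff_mem]
      exact ⟨hM, hL⟩
    · rw [Projectivization.submodule_mk]
      exact Submodule.mem_span_singleton_self x

theorem image_add_affStar (v : V) (M L : Submodule K V) :
    (fun x => v + x) '' affStar (points M \ points L) = cosetDiff v M L := by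
  rw [affStar_points_diff]
  ext x
  simp only [Set.mem_image, Set.mem_ofPred_eq, mem_cosetDiff]
  constructor
  · rintro ⟨y, hy, rfl⟩
    simpa using hy
  · intro h
    exact ⟨x - v, h, by abel⟩

theorem mem_vDeltaTranslate {n : ℕ} {v : V} {L : Submodule K V} {p : Sym2 (Set V)} :
    p ∈ vDeltaTranslate Q n v L ↔ ∃ M ∈ sigma Q n L, ∃ N ∈ sigma Q n L, M ≠ N ∧
      p = s(cosetDiff v M L, cosetDiff v N L) := by
  unfold vDeltaTranslate vDelta
  constructor
  · rintro ⟨_, ⟨M, hM, N, hN, hne, rfl⟩, rfl⟩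
    exact ⟨M, hM, N, hN, hne, by rw [Sym2.map_mk, image_add_affStar, image_add_affStar]⟩
  · rintro ⟨M, hM, N, hN, hne, rfl⟩
    exact ⟨_, ⟨M, hM, N, hN, hne, rfl⟩, by rw [Sym2.map_mk, image_add_affStar, image_add_affStar]⟩

/-- Two maximal singular subspaces `M`, `N` whose intersection has codimension one in both. -/
structure IsAdjacentPair (Q : QuadraticForm K V) (m : ℕ) (M N : Submodule K V) : Prop where
  singular_left : IsSingular Q M
  singular_right : IsSingular Q N
  finrank_left : finrank K M = m
  finrank_right : finrank K N = m
  finrank_inf : finrank K (M ⊓ N : Submodule K V) + 1 = m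

theorem IsAdjacentPair.symm {M N : Submodule K V} (h : IsAdjacentPair Q m M N) :
    IsAdjacentPair Q m N M :=
  ⟨h.2, h.1, h.4, h.3, by rw [inf_comm]; exact h.5⟩

theorem ncard_cosetDiff [Fintype K] [Fintype V] (v : V) (M L : Submodule K V) :
    (cosetDiff v M L).ncard + Fintype.card K ^ finrank K (M ⊓ L : Submodule K V) =
      Fintype.card K ^ finrank K M := by
  classical
  rw [← card_not_mem M L]
  congr 1
  have : cosetDiff v M L = ↑(Finset.univ.filter fun x => x - v ∈ M ∧ x - v ∉ L) := by
    ext x; simp [mem_cosetDiff]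
  rw [this, Set.ncard_coe_finset]
  exact Finset.card_equiv (Equiv.subRight v) fun x => by simp

variable [FiniteDimensional K V]

theorem inf_eq_of_finrank {M N L : Submodule K V} (hM : finrank K M = m) (hN : finrank K N = m)
    (hL : finrank K L + 1 = m) (hne : M ≠ N) (hLM : L ≤ M) (hLN : L ≤ N) : M ⊓ N = L := by
  refine (Submodule.eq_of_le_of_finrank_le (le_inf hLM hLN) ?_).symm
  by_contra! h
  have h1 := Submodule.finrank_mono (inf_le_left : M ⊓ N ≤ M)
  have h2 : M ⊓ N = M := Submodule.eq_of_le_of_finrank_eq inf_le_left (by omega)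
  exact hne (Submodule.eq_of_le_of_finrank_eq (inf_eq_left.1 h2) (by omega))

/-- Distinct members of `sigma Q m L` meet exactly in `L`, so `L` can be eliminated in favour of `M
⊓ N`. -/
theorem exists_mem_vDeltaTranslate_iff {p : Sym2 (Set V)} :
    (∃ (v : V) (L : Submodule K V), IsSingular Q L ∧
        projDim L = (m : ℤ) - 2 ∧ p ∈ vDeltaTranslate Q m v L) ↔
      ∃ (v : V) (M N : Submodule K V), IsAdjacentPair Q m M N ∧
        p = s(cosetDiff v M (M ⊓ N), cosetDiff v N (M ⊓ N)) := by
  constructor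
  · rintro ⟨v, L, hL, hLm, hp⟩
    obtain ⟨M, ⟨hM, hLM, hMm⟩, N, ⟨hN, hLN, hNm⟩, hne, rfl⟩ := mem_vDeltaTranslate.1 hp
    simp only [projDim] at hLm hMm hNm
    have hinf := inf_eq_of_finrank (m := m) (by omega) (by omega) (by omega) hne hLM.le hLN.le
    exact ⟨v, M, N, ⟨hM, hN, by omega, by omega, by rw [hinf]; omega⟩, by rw [hinf]⟩
  · rintro ⟨v, M, N, h, rfl⟩
    have h3 := h.finrank_left
    have h4 := h.finrank_right
    have h5 := h.finrank_inf
    have hlt : ∀ X : Submodule K V, M ⊓ N ≤ X → finrank K X = m → M ⊓ N < X := by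
      intro X hX hXm
      refine lt_of_le_of_ne hX fun he => ?_
      rw [he] at h5
      omega
    refine ⟨v, M ⊓ N, h.singular_left.mono inf_le_left, ?_, mem_vDeltaTranslate.2
      ⟨M, ⟨h.singular_left, hlt M inf_le_left h3, ?_⟩, N,
        ⟨h.singular_right, hlt N inf_le_right h4, ?_⟩, ?_, rfl⟩⟩
    · simp only [projDim]; omega
    · simp only [projDim]; omega
    · simp only [projDim]; omega
    · rintro rfl
      rw [inf_idem] at h5
      omega

/-- If `x` were orthogonal to `y`, it would be orthogonal to `(M ⊓ N) + ⟨y⟩ = N`, hence lie in `N^⊥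
= N`. -/
theorem IsAdjacentPair.polar_ne_zero (hQ : IsHyperbolic Q m) {M N : Submodule K V}
    (h : IsAdjacentPair Q m M N) {x y : V} (hx : x ∈ M) (hxL : x ∉ M ⊓ N) (hy : y ∈ N)
    (hyL : y ∉ M ⊓ N) : polar Q x y ≠ 0 := by
  intro h0
  have h4 := h.finrank_right
  have h5 := h.finrank_inf
  have hle : M ⊓ N ⊔ Submodule.span K {y} ≤ N :=
    sup_le inf_le_right ((Submodule.span_singleton_le_iff_mem _ _).2 hy)
  have hlt : M ⊓ N < M ⊓ N ⊔ Submodule.span K {y} := by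
    refine lt_of_le_of_ne le_sup_left fun he => hyL ?_
    rw [he]
    exact Submodule.mem_sup_right (Submodule.mem_span_singleton_self y)
  have hlt' := Submodule.finrank_lt_finrank_of_lt hlt
  have heq : M ⊓ N ⊔ Submodule.span K {y} = N :=
    Submodule.eq_of_le_of_finrank_le hle (by omega)
  have hxP : x ∈ perp Q N := by
    rw [← heq, perp_sup]
    exact ⟨perp_anti inf_le_left (h.singular_left.le_perp hx), mem_perp_span_singleton.2 h0⟩
  rw [hQ.perp_eq_self h.singular_right h4] at hxP
  exact hxL ⟨hx, hxP⟩

theorem IsAdjacentPair.isIsolatedPair (hQ : IsHyperbolic Q m) {M N : Submodule K V}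
    (h : IsAdjacentPair Q m M N) (v : V) :
    IsIsolatedPair (affinePolarGraph Q) (cosetDiff v M (M ⊓ N)) (cosetDiff v N (M ⊓ N)) where
  clique_left x hx y hy hxy := ⟨hxy, h.singular_left _ (by simpa using M.sub_mem hx.1 hy.1)⟩
  clique_right x hx y hy hxy := ⟨hxy, h.singular_right _ (by simpa using N.sub_mem hx.1 hy.1)⟩
  disjoint := Set.disjoint_left.2 fun x hx hy => hx.2 ⟨hx.1, hy.1⟩
  not_adj x hx y hy hadj := by
    refine h.polar_ne_zero hQ hx.1 hx.2 hy.1 hy.2 ?_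
    have := hadj.2
    rw [← sub_sub_sub_cancel_right x y v, map_sub_eq, h.singular_left _ hx.1,
      h.singular_right _ hy.1, add_zero, zero_sub, neg_eq_zero] at this
    exact this

/-- The two maximal singular subspaces through a singular subspace of dimension `m - 1`. -/
theorem IsHyperbolic.adjacentPair_of_hyperbolic_pair (hQ : IsHyperbolic Q m) {L : Submodule K V}
    (hL : IsSingular Q L) (hLm : finrank K L + 1 = m) {e f : V} (he : Q e = 0) (hf : Q f = 0)
    (hef : polar Q e f = 1) (heL : e ∈ perp Q L) (hfL : f ∈ perp Q L) :
    IsAdjacentPair Q m (L ⊔ Submodule.span K {e}) (L ⊔ Submodule.span K {f}) ∧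
      (L ⊔ Submodule.span K {e}) ⊓ (L ⊔ Submodule.span K {f}) = L := by
  have hsing {x : V} (hx : Q x = 0) (hxL : x ∈ perp Q L) :
      IsSingular Q (L ⊔ Submodule.span K {x}) := by
    rw [sup_comm]
    exact (isSingular_span_singleton hx).sup hL ((Submodule.span_singleton_le_iff_mem _ _).2 hxL)
  have hrank {x y : V} (hxy : polar Q x y = 1) (hx : Q x = 0) (hxL : x ∈ perp Q L)
      (hyL : y ∈ perp Q L) : finrank K (L ⊔ Submodule.span K {x} : Submodule K V) = m := by
    refine le_antisymm (hQ.finrank_le (hsing hx hxL)) ?_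
    have hlt : L < L ⊔ Submodule.span K {x} := by
      refine lt_of_le_of_ne le_sup_left fun heq => ?_
      have hx : x ∈ L := by
        rw [heq]; exact Submodule.mem_sup_right (Submodule.mem_span_singleton_self x)
      rw [mem_perp.1 hyL x hx] at hxy
      exact zero_ne_one hxy
    have := Submodule.finrank_lt_finrank_of_lt hlt
    omega
  have hfe : polar Q f e = 1 := by rw [polar_comm, hef]
  have hne : L ⊔ Submodule.span K {e} ≠ L ⊔ Submodule.span K {f} := by
    intro heq
    have h1 : e ∈ L ⊔ Submodule.span K {f} := by
      rw [← heq]; exact Submodule.mem_sup_right (Submodule.mem_span_singleton_self e)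
    have h2 : f ∈ L ⊔ Submodule.span K {f} :=
      Submodule.mem_sup_right (Submodule.mem_span_singleton_self f)
    rw [(hsing hf hfL).polar_eq_zero h1 h2] at hef
    exact zero_ne_one hef
  have hinf := inf_eq_of_finrank (hrank hef he heL hfL) (hrank hfe hf hfL heL) hLm hne
    le_sup_left le_sup_left
  exact ⟨⟨hsing he heL, hsing hf hfL, hrank hef he heL hfL, hrank hfe hf hfL heL,
    by rw [hinf]; exact hLm⟩, hinf⟩

/-- On `L^⊥` one has `Q (l + a e + b f) = a b`, so a singular vector there has `a = 0` or `b = 0`.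
-/
theorem IsHyperbolic.mem_sup_span_or (hQ : IsHyperbolic Q m) {L M : Submodule K V}
    (hL : IsSingular Q L) (hLm : finrank K L + 1 = m) {e f : V} (he : Q e = 0) (hf : Q f = 0)
    (hef : polar Q e f = 1) (heL : e ∈ perp Q L) (hfL : f ∈ perp Q L)
    (hperp : ∀ x, x ∈ perp Q L ↔ ∃ l ∈ L, ∃ a b : K, x = l + a • e + b • f)
    (hM : IsSingular Q M) (hMm : finrank K M = m) (hLM : L ≤ M) :
    M = L ⊔ Submodule.span K {e} ∨ M = L ⊔ Submodule.span K {f} := by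
  obtain ⟨hadj, -⟩ := hQ.adjacentPair_of_hyperbolic_pair hL hLm he hf hef heL hfL
  obtain ⟨x, hxM, hxL⟩ : ∃ x ∈ M, x ∉ L := by
    by_contra! h
    have := Submodule.finrank_mono (show M ≤ L from h)
    omega
  have hgen : ∀ N : Submodule K V, L ≤ N → finrank K N = m → x ∈ N → M = N := by
    intro N hLN hNm hxN
    by_contra hne
    rw [← inf_eq_of_finrank hMm hNm hLm hne hLM hLN] at hxL
    exact hxL ⟨hxM, hxN⟩
  obtain ⟨l, hl, a, b, hx⟩ := (hperp x).1 (perp_anti hLM (hM.le_perp hxM))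
  have h0 := hM x hxM
  have h1 : polar Q l e = 0 := mem_perp.1 heL l hl
  have h2 : polar Q l f = 0 := mem_perp.1 hfL l hl
  rw [hx, map_add_eq, map_add_eq, hL l hl, QuadraticMap.map_smul, QuadraticMap.map_smul,
    polar_add_left, polar_smul_right, polar_smul_right, polar_smul_left, polar_smul_right,
    he, hf, hef, h1, h2] at h0
  have hab : a = 0 ∨ b = 0 := by simpa [or_comm] using h0
  rcases hab with rfl | rfl
  · right
    refine hgen _ le_sup_left hadj.finrank_right ?_
    rw [hx, zero_smul, add_zero]
    exact Submodule.add_mem_sup hl (Submodule.smul_mem _ _ (Submodule.mem_span_singleton_self f))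
  · left
    refine hgen _ le_sup_left hadj.finrank_left ?_
    rw [hx, zero_smul, add_zero]
    exact Submodule.add_mem_sup hl (Submodule.smul_mem _ _ (Submodule.mem_span_singleton_self e))

end Pairs

/-! ### Classification of the isolated pairs. -/

section Classification

variable {K V : Type*} [Field K] [AddCommGroup V] [Module K V] {Q : QuadraticForm K V} {m : ℕ}

theorem IsIsolatedPair.map_sub_ne_zero {T₀ T₁ : Set V}
    (h : IsIsolatedPair (affinePolarGraph Q) T₀ T₁) {x y : V} (hx : x ∈ T₀) (hy : y ∈ T₁) :
    Q (x - y) ≠ 0 := fun h0 =>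
  h.not_adj x hx y hy ⟨fun he => Set.disjoint_left.1 h.disjoint hx (he ▸ hy), h0⟩

theorem IsIsolatedPair.symm {V : Type*} {G : SimpleGraph V} {T₀ T₁ : Set V}
    (h : IsIsolatedPair G T₀ T₁) :
    IsIsolatedPair G T₁ T₀ :=
  ⟨h.2, h.1, h.3.symm, fun x hx y hy hadj => h.4 y hy x hx hadj.symm⟩

/-- A clique of the affine polar graph lies in a coset of a maximal singular subspace. -/
theorem IsHyperbolic.exists_of_isClique [FiniteDimensional K V] (hQ : IsHyperbolic Q m)
    {T : Set V} (hT : (affinePolarGraph Q).IsClique T) {a : V} (ha : a ∈ T) :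
    ∃ M : Submodule K V, IsSingular Q M ∧ finrank K M = m ∧ ∀ x ∈ T, x - a ∈ M := by
  have h0 : ∀ x ∈ T, ∀ y ∈ T, Q (x - y) = 0 := by
    intro x hx y hy
    by_cases hxy : x = y
    · simp [hxy]
    · exact (hT hx hy hxy).2
  have hs : IsSingular Q (Submodule.span K ((· - a) '' T)) := by
    refine isSingular_span ?_ ?_
    · rintro _ ⟨x, hx, rfl⟩
      exact h0 x hx a ha
    · rintro _ ⟨x, hx, rfl⟩ _ ⟨y, hy, rfl⟩
      have := map_sub_eq (Q := Q) (x - a) (y - a)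
      rw [sub_sub_sub_cancel_right, h0 x hx y hy, h0 x hx a ha, h0 y hy a ha, add_zero,
        zero_sub, eq_comm, neg_eq_zero] at this
      exact this
  obtain ⟨M, hle, hM, hMm⟩ := hQ.exists_le_singular hs
  exact ⟨M, hM, hMm, fun x hx => hle (Submodule.subset_span ⟨x, hx, rfl⟩)⟩

/-- With `v` in both cosets, `Q (x - y)` is minus the polar form of `x - v` and `y - v`. A vector of
`v + M` outside `T₀` is then orthogonal to `T₁ - v`, the complement of a hyperplane in `N`. Such a
complement spans `N`, so `x - v` lies in `N^⊥ = N`. -/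
theorem cosetDiff_of_common_point [FiniteDimensional K V] (hQ : IsHyperbolic Q m) {T₀ T₁ : Set V}
    {M N : Submodule K V} (hM : IsSingular Q M) (hN : IsSingular Q N)
    (hNm : finrank K N = m) {v : V}
    (hT₀ : ∀ y ∈ T₁, T₀ = {x | x - v ∈ M ∧ Q (x - y) ≠ 0})
    (hT₁ : ∀ x ∈ T₀, T₁ = {y | y - v ∈ N ∧ Q (y - x) ≠ 0})
    (hne₀ : T₀.Nonempty) (hne₁ : T₁.Nonempty) : T₀ = cosetDiff v M (M ⊓ N) := by
  have hpol : ∀ x y : V, x - v ∈ M → y - v ∈ N → Q (x - y) = -polar Q (x - v) (y - v) := by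
    intro x y hx hy
    rw [← sub_sub_sub_cancel_right x y v, map_sub_eq, hM _ hx, hN _ hy]; ring
  obtain ⟨x₀, hx₀⟩ := hne₀
  obtain ⟨y₀, hy₀⟩ := hne₁
  have hy₀N : y₀ - v ∈ N := by
    have := hy₀
    rw [hT₁ x₀ hx₀] at this
    exact this.1
  have hT₀M : ∀ x ∈ T₀, x - v ∈ M := by
    intro x hx
    rw [hT₀ y₀ hy₀] at hx
    exact hx.1
  have hmem : ∀ y, y - v ∈ N → (y ∈ T₁ ↔ polar Q (x₀ - v) (y - v) ≠ 0) := by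
    intro y hy
    rw [hT₁ x₀ hx₀]
    simp only [Set.mem_ofPred_eq, hy, true_and]
    rw [← neg_sub x₀ y, QuadraticMap.map_neg, hpol _ _ (hT₀M _ hx₀) hy, neg_ne_zero]
  ext x
  constructor
  · intro hx
    refine ⟨hT₀M x hx, fun hxL => ?_⟩
    rw [hT₀ y₀ hy₀] at hx
    refine hx.2 ?_
    rw [hpol _ _ hx.1 hy₀N, hN.polar_eq_zero hxL.2 hy₀N, neg_zero]
  · rintro ⟨hxM, hxL⟩
    by_contra hx
    have hzero : ∀ y ∈ T₁, polar Q (x - v) (y - v) = 0 := by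
      intro y hy
      have hyN : y - v ∈ N := by
        rw [hT₁ x₀ hx₀] at hy
        exact hy.1
      rw [hT₀ y hy] at hx
      by_contra hne
      exact hx ⟨hxM, by rw [hpol _ _ hxM hyN]; exact neg_ne_zero.2 hne⟩
    have hxP : x - v ∈ perp Q N := by
      rw [mem_perp']
      intro n hn
      -- If `n` is in the hyperplane, it is the difference of `y₀ + n - v` and `y₀ - v`, both
      -- outside it.
      by_cases hn' : v + n ∈ T₁
      · simpa using hzero _ hn'
      · have h1 : polar Q (x₀ - v) n = 0 := by
          by_contra hne
          exact hn' ((hmem _ (by simpa using hn)).2 (by simpa using hne))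
        have h2 : y₀ + n ∈ T₁ := by
          have hN' : y₀ + n - v ∈ N := by
            rw [add_sub_right_comm]; exact N.add_mem hy₀N hn
          rw [hmem _ hN', add_sub_right_comm, polar_add_right, h1, add_zero]
          exact (hmem _ hy₀N).1 hy₀
        have h3 := hzero _ h2
        rw [add_sub_right_comm, polar_add_right, hzero _ hy₀, zero_add] at h3
        exact h3
    rw [hQ.perp_eq_self hN hNm] at hxP
    exact hxL ⟨hxM, hxP⟩

variable [Fintype K] [Fintype V]
local notation "q" => Fintype.card K

/-- A vector outside a coset of a maximal singular subspace is adjacent to exactly a proportion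
`1 / q` of the coset. -/
theorem IsHyperbolic.ncard_coset_singular (hQ : IsHyperbolic Q m) (hm : 1 ≤ m)
    {M : Submodule K V} (hM : IsSingular Q M) (hMm : finrank K M = m) {a y : V}
    (hy : y - a ∉ M) :
    {x | x - a ∈ M ∧ Q (x - y) = 0}.ncard = q ^ (m - 1) ∧
      {x | x - a ∈ M ∧ Q (x - y) ≠ 0}.ncard + q ^ (m - 1) = q ^ m := by
  classical
  have h' : a - y ∉ perp Q M := by
    rw [hQ.perp_eq_self hM hMm, ← neg_sub, M.neg_mem_iff]
    exact hy
  have key := hM.card_coset h'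
  rw [card_filter_mem, hMm] at key
  have e1 : {x | x - a ∈ M ∧ Q (x - y) = 0}.ncard =
      (Finset.univ.filter fun w => w ∈ M ∧ Q (a - y + w) = 0).card := by
    have : {x | x - a ∈ M ∧ Q (x - y) = 0} =
        ↑(Finset.univ.filter fun x => x - a ∈ M ∧ Q (x - y) = 0) := by ext x; simp
    rw [this, Set.ncard_coe_finset]
    refine Finset.card_equiv (Equiv.subRight a) fun x => ?_
    simp only [Finset.mem_filter, Finset.mem_univ, true_and, Equiv.subRight_apply]
    rw [show a - y + (x - a) = x - y by abel]
  have e2 : {x | x - a ∈ M ∧ Q (x - y) = 0}.ncard +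
      {x | x - a ∈ M ∧ Q (x - y) ≠ 0}.ncard = q ^ m := by
    rw [← Set.ncard_union_eq (Set.disjoint_left.2 fun x hx hx' => hx'.2 hx.2)]
    have h1 := ncard_cosetDiff a M ⊥
    have h2 : {x | x - a ∈ M ∧ Q (x - y) = 0} ∪ {x | x - a ∈ M ∧ Q (x - y) ≠ 0} =
        insert a (cosetDiff a M ⊥) := by
      ext x
      simp only [Set.mem_union, Set.mem_ofPred_eq, Set.mem_insert_iff, mem_cosetDiff,
        Submodule.mem_bot, sub_eq_zero]
      by_cases hx : x = a
      · subst hx; simp [em]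
      · simp only [hx, false_or, not_false_eq_true, and_true, ← and_or_left, em]
    rw [h2, Set.ncard_insert_of_notMem (by simp [mem_cosetDiff])]
    rw [inf_bot_eq, finrank_bot, pow_zero, hMm] at h1
    exact h1
  have e3 : {x | x - a ∈ M ∧ Q (x - y) = 0}.ncard = q ^ (m - 1) := by
    refine Nat.eq_of_mul_eq_mul_right (Fintype.card_pos (α := K)) ?_
    rw [e1, key, ← pow_succ, Nat.sub_add_cancel hm]
  exact ⟨e3, by omega⟩

/-- `T₀` is contained in the set of vectors of `a + M` not adjacent to `y`, and the two have the
same size. -/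
theorem IsHyperbolic.eq_of_isIsolatedPair (hQ : IsHyperbolic Q m) (hm : 1 ≤ m)
    {T₀ T₁ : Set V} (h : IsIsolatedPair (affinePolarGraph Q) T₀ T₁)
    (hc : T₀.ncard + q ^ (m - 1) = q ^ m) {M : Submodule K V} (hM : IsSingular Q M)
    (hMm : finrank K M = m) {a : V} (ha : a ∈ T₀) (hTM : ∀ x ∈ T₀, x - a ∈ M) {y : V}
    (hy : y ∈ T₁) : T₀ = {x | x - a ∈ M ∧ Q (x - y) ≠ 0} := by
  have hyM : y - a ∉ M := by
    intro hyM
    refine h.map_sub_ne_zero ha hy ?_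
    rw [← neg_sub, QuadraticMap.map_neg]
    exact hM _ hyM
  have := (hQ.ncard_coset_singular hm hM hMm hyM).2
  refine Set.eq_of_subset_of_ncard_le (fun x hx => ⟨hTM x hx, h.map_sub_ne_zero hx hy⟩)
    (by omega) (Set.toFinite _)

theorem eq_one_of_card_eq_two (hq : q = 2) {c : K} (hc : c ≠ 0) : c = 1 := by
  classical
  by_contra h
  have : ({0, 1, c} : Finset K).card = 3 := by
    rw [Finset.card_eq_three]
    exact ⟨0, 1, c, zero_ne_one, hc.symm, Ne.symm h, rfl⟩
  have h2 := Finset.card_le_univ ({0, 1, c} : Finset K)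
  omega

/-- The part of the classification where the two cosets carrying the cliques are disjoint: then
`q = 2` and the vectors of the first clique differ by vectors of the second subspace. -/
theorem sub_mem_of_disjoint_cosets (hQ : IsHyperbolic Q m) (hm : 1 ≤ m) {T₀ T₁ : Set V}
    (h : IsIsolatedPair (affinePolarGraph Q) T₀ T₁)
    (hc₀ : T₀.ncard + q ^ (m - 1) = q ^ m) {M N : Submodule K V} (hM : IsSingular Q M)
    (hN : IsSingular Q N) (hMm : finrank K M = m) (hNm : finrank K N = m) {a b : V}
    (ha : a ∈ T₀) (hT₀ : ∀ x ∈ T₀, x - a ∈ M)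
    (hT₁ : ∀ x ∈ T₀, T₁ = {y | y - b ∈ N ∧ Q (y - x) ≠ 0})
    (hdis : ∀ v, v - a ∈ M → v - b ∉ N) : q = 2 ∧ ∀ x ∈ T₀, x - a ∈ N := by
  have hq2 : 2 ≤ q := Fintype.one_lt_card
  have hpow : q ^ m = q * q ^ (m - 1) := by rw [← pow_succ', Nat.sub_add_cancel hm]
  have hpos : 0 < q ^ (m - 1) := by positivity
  have hz0 : ∀ z, z - b ∈ N → z ∉ T₁ → ∀ x ∈ T₀, Q (x - z) = 0 := by
    intro z hz hzT x hx
    by_contra hne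
    rw [hT₁ x hx] at hzT
    refine hzT ⟨hz, ?_⟩
    rwa [← neg_sub, QuadraticMap.map_neg]
  -- Some `z` in `b + N` lies outside `T₁`. It is adjacent to all of `T₀`, but, being outside `a +
  -- M`, to only `q^(m-1)` vectors of that coset. Hence `q^m - q^(m-1) ≤ q^(m-1)`.
  have hqe : q = 2 := by
    have h1 := (hQ.ncard_coset_singular hm hN hNm (hdis a (by simp))).1
    obtain ⟨z, hz, hz'⟩ : {y | y - b ∈ N ∧ Q (y - a) = 0}.Nonempty := by
      rw [Set.nonempty_iff_ne_empty]
      intro he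
      rw [he, Set.ncard_empty] at h1
      omega
    have hzT : z ∉ T₁ := by
      rw [hT₁ a ha]
      exact fun h => h.2 hz'
    have h2 := (hQ.ncard_coset_singular hm hM hMm (fun hz' => hdis z hz' hz)).1
    have h3 : T₀.ncard ≤ q ^ (m - 1) := by
      rw [← h2]
      exact Set.ncard_le_ncard (fun x hx => ⟨hT₀ x hx, hz0 z hz hzT x hx⟩) (Set.toFinite _)
    have h4 : q * q ^ (m - 1) ≤ 2 * q ^ (m - 1) := by omega
    have := Nat.le_of_mul_le_mul_right h4 hpos
    omega
  refine ⟨hqe, fun x hx => ?_⟩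
  -- Over two elements, `Q (x - z)` is 1 for `z` in `T₁` and 0 for the rest of `b + N`, whichever
  -- `x` in `T₀` is taken. Comparing `x` with `a` makes `x - a` orthogonal to `N`.
  have hconst : ∀ z, z - b ∈ N → Q (x - z) = Q (a - z) := by
    intro z hz
    by_cases hzT : z ∈ T₁
    · rw [eq_one_of_card_eq_two hqe (h.map_sub_ne_zero hx hzT),
        eq_one_of_card_eq_two hqe (h.map_sub_ne_zero ha hzT)]
    · rw [hz0 z hz hzT x hx, hz0 z hz hzT a ha]
  have hpol : ∀ z, z - b ∈ N → polar Q (x - a) (a - z) = 0 := by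
    intro z hz
    have h1 := hconst z hz
    rw [← sub_add_sub_cancel x a z, map_add_eq, hM _ (hT₀ x hx), zero_add] at h1
    exact left_eq_add.1 h1.symm
  have hxP : x - a ∈ perp Q N := by
    rw [mem_perp']
    intro n hn
    have h1 := hpol b (by simp)
    have h2 := hpol (b + n) (by simpa using hn)
    rw [← sub_sub, polar_sub_right, h1, zero_sub, neg_eq_zero] at h2
    exact h2
  rwa [hQ.perp_eq_self hN hNm] at hxP

theorem cosetDiff_of_card_eq_two {K V : Type*} [Field K] [Fintype K] [AddCommGroup V] [Module K V]
    (hq : Fintype.card K = 2) {L : Submodule K V} (v : V) {e : V} (he : e ∉ L) :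
    cosetDiff v (L ⊔ Submodule.span K {e}) L = {x | x - (v + e) ∈ L} := by
  ext x
  rw [mem_cosetDiff, Set.mem_ofPred_eq]
  constructor
  · rintro ⟨hx, hxL⟩
    obtain ⟨l, hl, y, hy, hxy⟩ := Submodule.mem_sup.1 hx
    obtain ⟨c, rfl⟩ := Submodule.mem_span_singleton.1 hy
    have hc : c ≠ 0 := by
      rintro rfl
      rw [zero_smul, add_zero] at hxy
      exact hxL (hxy ▸ hl)
    rw [eq_one_of_card_eq_two hq hc, one_smul] at hxy
    rw [← sub_sub, ← hxy, add_sub_cancel_right]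
    exact hl
  · intro hx
    have h1 : x - v = (x - (v + e)) + e := by abel
    rw [h1, L.add_mem_iff_right hx]
    exact ⟨Submodule.add_mem_sup hx (Submodule.mem_span_singleton_self e), he⟩

/-- Over the field with two elements, two cosets of a singular subspace of dimension `m - 1` whose
difference is orthogonal to it and nonsingular arise from an adjacent pair. -/
theorem IsHyperbolic.exists_adjacentPair_of_card_eq_two (hQ : IsHyperbolic Q m) (hq : q = 2)
    {L : Submodule K V} (hL : IsSingular Q L) (hLm : finrank K L + 1 = m) {a b : V}
    (hab : b - a ∈ perp Q L) (h0 : Q (b - a) ≠ 0) :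
    ∃ (v : V) (M N : Submodule K V), IsAdjacentPair Q m M N ∧
      {x | x - a ∈ L} = cosetDiff v M (M ⊓ N) ∧ {x | x - b ∈ L} = cosetDiff v N (M ⊓ N) := by
  obtain ⟨e, f, he, hf, hef, heL, hfL, hperp⟩ := hQ.exists_hyperbolic_pair hL hLm
  obtain ⟨hadj, hinf⟩ := hQ.adjacentPair_of_hyperbolic_pair hL hLm he hf hef heL hfL
  have heL' : e ∉ L := fun h => by
    rw [mem_perp.1 hfL e h] at hef
    exact zero_ne_one hef
  have hfL' : f ∉ L := fun h => by
    rw [polar_comm, mem_perp.1 heL f h] at hef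
    exact zero_ne_one hef
  -- Here `Q (b - a) = c d` is nonzero, so `c = d = 1` and `b - a` is `e + f` modulo `L`.
  obtain ⟨l, hl, c, d, hcd⟩ := (hperp _).1 hab
  have hl1 : polar Q l e = 0 := mem_perp.1 heL l hl
  have hl2 : polar Q l f = 0 := mem_perp.1 hfL l hl
  have h1 : c * d ≠ 0 := by
    intro h
    rw [hcd, map_add_eq, map_add_eq, hL l hl, QuadraticMap.map_smul, QuadraticMap.map_smul,
      polar_add_left, polar_smul_right, polar_smul_right, polar_smul_left, polar_smul_right,
      he, hf, hef, hl1, hl2] at h0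
    exact h0 (by simpa [or_comm] using h)
  rw [eq_one_of_card_eq_two hq (left_ne_zero_of_mul h1),
    eq_one_of_card_eq_two hq (right_ne_zero_of_mul h1), one_smul, one_smul] at hcd
  have h2 : e + e = 0 := by
    have h2 : (2 : K) = 0 := by
      by_contra h
      have := eq_one_of_card_eq_two hq h
      rw [← one_add_one_eq_two] at this
      exact one_ne_zero (add_eq_left.1 this)
    rw [← two_smul K, h2, zero_smul]
  -- From this base point `v`, `v + e = a`, and `v + f` is congruent to `b` modulo `L` because `2 e
  -- = 0`.
  refine ⟨a - e, _, _, hadj, ?_, ?_⟩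
  · rw [hinf, cosetDiff_of_card_eq_two hq _ heL', sub_add_cancel]
  · rw [hinf, cosetDiff_of_card_eq_two hq _ hfL']
    ext x
    rw [Set.mem_ofPred_eq, Set.mem_ofPred_eq]
    have h3 : x - (a - e + f) = (x - b) + l := by
      have : b = a + (l + e + f) := by rw [← hcd]; abel
      rw [this]
      have h4 : x - (a - e + f) = x - (a + (l + e + f)) + l + (e + e) := by abel
      rw [h4, h2, add_zero]
    rw [h3, L.add_mem_iff_left hl]

theorem IsHyperbolic.exists_adjacentPair (hQ : IsHyperbolic Q m) (hm : 1 ≤ m)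
    {T₀ T₁ : Set V} (h : IsIsolatedPair (affinePolarGraph Q) T₀ T₁)
    (hc₀ : T₀.ncard + q ^ (m - 1) = q ^ m) (hc₁ : T₁.ncard + q ^ (m - 1) = q ^ m) :
    ∃ (v : V) (M N : Submodule K V), IsAdjacentPair Q m M N ∧
      T₀ = cosetDiff v M (M ⊓ N) ∧ T₁ = cosetDiff v N (M ⊓ N) := by
  have hq2 : 1 < q := Fintype.one_lt_card
  have hlt : q ^ (m - 1) < q ^ m := Nat.pow_lt_pow_right hq2 (by omega)
  have hne {T : Set V} (hT : T.ncard + q ^ (m - 1) = q ^ m) : T.Nonempty := by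
    rw [Set.nonempty_iff_ne_empty]
    rintro rfl
    rw [Set.ncard_empty] at hT
    omega
  obtain ⟨a, ha⟩ := hne hc₀
  obtain ⟨b, hb⟩ := hne hc₁
  obtain ⟨M, hM, hMm, hTM⟩ := hQ.exists_of_isClique h.clique_left ha
  obtain ⟨N, hN, hNm, hTN⟩ := hQ.exists_of_isClique h.clique_right hb
  have hT₀ := fun y (hy : y ∈ T₁) => hQ.eq_of_isIsolatedPair hm h hc₀ hM hMm ha hTM hy
  have hT₁ := fun x (hx : x ∈ T₀) => hQ.eq_of_isIsolatedPair hm h.symm hc₁ hN hNm hb hTN hx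
  by_cases hv : ∃ v, v - a ∈ M ∧ v - b ∈ N
  · obtain ⟨v, hva, hvb⟩ := hv
    have hMv : ∀ x, x - a ∈ M ↔ x - v ∈ M := fun x => by
      rw [← sub_add_sub_cancel x v a, M.add_mem_iff_left hva]
    have hNv : ∀ x, x - b ∈ N ↔ x - v ∈ N := fun x => by
      rw [← sub_add_sub_cancel x v b, N.add_mem_iff_left hvb]
    simp only [hMv] at hT₀
    simp only [hNv] at hT₁
    have h0 := cosetDiff_of_common_point hQ hM hN hNm hT₀ hT₁ ⟨a, ha⟩ ⟨b, hb⟩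
    have h1 := cosetDiff_of_common_point hQ hN hM hMm hT₁ hT₀ ⟨b, hb⟩ ⟨a, ha⟩
    refine ⟨v, M, N, ⟨hM, hN, hMm, hNm, ?_⟩, h0, by rw [h1, inf_comm]⟩
    -- The size of `T₀` forces the dimension of `M ⊓ N`.
    have h2 := ncard_cosetDiff v M (M ⊓ N)
    rw [← h0, ← inf_assoc, inf_idem, hMm, ← hc₀] at h2
    have := Nat.pow_right_injective hq2 (Nat.add_left_cancel h2)
    omega
  · push Not at hv
    obtain ⟨hq, hsub₀⟩ := sub_mem_of_disjoint_cosets hQ hm h hc₀ hM hN hMm hNm ha hTM hT₁ hv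
    obtain ⟨-, hsub₁⟩ := sub_mem_of_disjoint_cosets hQ hm h.symm hc₁ hN hM hNm hMm hb hTN hT₀
      (fun v h1 h2 => hv v h2 h1)
    set P := perp Q (Submodule.span K {b - a}) with hP
    -- With `Q (c - d) = 1`, `Q (x - d)` is `1 + polar Q (x - c) (c - d)`, so nonadjacency becomes
    -- orthogonality. Each clique is thus a coset of a subspace, and the two inclusions from
    -- `sub_mem_of_disjoint_cosets` identify these subspaces.
    have hval {A : Submodule K V} (hA : IsSingular Q A) {c d x : V} (hcd : Q (c - d) ≠ 0)
        (hx : x - c ∈ A) : Q (x - d) ≠ 0 ↔ polar Q (x - c) (c - d) = 0 := by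
      rw [← sub_add_sub_cancel x c d, map_add_eq, hA _ hx, zero_add,
        eq_one_of_card_eq_two hq hcd]
      constructor
      · intro h1
        exact left_eq_add.1 (eq_one_of_card_eq_two hq h1).symm
      · intro h1
        simp [h1]
    have hab := h.map_sub_ne_zero ha hb
    have hba := h.symm.map_sub_ne_zero hb ha
    have e0 : T₀ = {x | x - a ∈ M ⊓ P} := by
      rw [hT₀ b hb]
      ext x
      rw [Set.mem_ofPred_eq, Set.mem_ofPred_eq, Submodule.mem_inf]
      refine and_congr_right fun hx => ?_
      rw [hval hM hab hx, hP, mem_perp_span_singleton, ← neg_sub b a, polar_neg_right,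
        neg_eq_zero]
    have e1 : T₁ = {x | x - b ∈ N ⊓ P} := by
      rw [hT₁ a ha]
      ext x
      rw [Set.mem_ofPred_eq, Set.mem_ofPred_eq, Submodule.mem_inf]
      refine and_congr_right fun hx => ?_
      rw [hval hN hba hx, hP, mem_perp_span_singleton]
    have hle₀ : M ⊓ P ≤ N ⊓ P := fun x hx => ⟨by
      have h1 : x + a ∈ T₀ := by rw [e0]; simpa using hx
      simpa using hsub₀ _ h1, hx.2⟩
    have hle₁ : N ⊓ P ≤ M ⊓ P := fun x hx => ⟨by
      have h1 : x + b ∈ T₁ := by rw [e1]; simpa using hx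
      simpa using hsub₁ _ h1, hx.2⟩
    rw [← le_antisymm hle₀ hle₁] at e1
    have hLm : finrank K (M ⊓ P : Submodule K V) + 1 = m := by
      classical
      have h1 : T₀.ncard = q ^ finrank K (M ⊓ P : Submodule K V) := by
        rw [← card_filter_mem (M ⊓ P), e0]
        have : {x | x - a ∈ M ⊓ P} = ↑(Finset.univ.filter fun x => x - a ∈ M ⊓ P) := by
          ext x; simp
        rw [this, Set.ncard_coe_finset]
        exact Finset.card_equiv (Equiv.subRight a) fun x => by simp
      have h2 : q ^ m = q ^ (m - 1) + q ^ (m - 1) := by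
        rw [← two_mul, ← hq, ← pow_succ', Nat.sub_add_cancel hm]
      have := Nat.pow_right_injective hq2 (show q ^ finrank K (M ⊓ P : Submodule K V) =
        q ^ (m - 1) by omega)
      omega
    have hperp : b - a ∈ perp Q (M ⊓ P) := by
      rw [mem_perp]
      exact fun w hw => mem_perp_span_singleton.1 hw.2
    rw [e0, e1]
    exact hQ.exists_adjacentPair_of_card_eq_two hq (hM.mono inf_le_left) hLm hperp hba

theorem IsHyperbolic.mem_isolatedPairs_iff (hQ : IsHyperbolic Q m) (hm : 1 ≤ m)
    {p : Sym2 (Set V)} :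
    p ∈ isolatedPairs (affinePolarGraph Q) (theta1 (affinePolarGraph Q) + 1) ↔
      ∃ (v : V) (M N : Submodule K V), IsAdjacentPair Q m M N ∧
        p = s(cosetDiff v M (M ⊓ N), cosetDiff v N (M ⊓ N)) := by
  have hcard (T : Set V) : (T.ncard : ℝ) = theta1 (affinePolarGraph Q) + 1 ↔
      T.ncard + q ^ (m - 1) = q ^ m := by
    rw [hQ.theta1_eq hm, eq_sub_iff_add_eq]
    norm_cast
  unfold isolatedPairs
  simp only [hcard, Set.mem_ofPred_eq]
  constructor
  · rintro ⟨T₀, T₁, rfl, h, h0, h1⟩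
    obtain ⟨v, M, N, hadj, rfl, rfl⟩ := hQ.exists_adjacentPair hm h h0 h1
    exact ⟨v, M, N, hadj, rfl⟩
  · rintro ⟨v, M, N, h, rfl⟩
    have hrank : finrank K (M ⊓ N : Submodule K V) = m - 1 := by
      have := h.finrank_inf
      omega
    refine ⟨_, _, rfl, h.isIsolatedPair hQ v, ?_, ?_⟩
    · have := ncard_cosetDiff v M (M ⊓ N)
      rwa [← inf_assoc, inf_idem, hrank, h.finrank_left] at this
    · have := ncard_cosetDiff v N (M ⊓ N)
      rwa [inf_comm M N, ← inf_assoc, inf_idem, inf_comm N M, hrank, h.finrank_right] at this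

end Classification

/-! ### Counting singular subspaces through their ordered bases. -/

section SubspaceCount

open scoped Classical
open Finset (univ)

variable {K V : Type*} [Field K] [AddCommGroup V] [Module K V]
  {Q : QuadraticForm K V} {m : ℕ}

theorem isSingular_span_insert {s : Set V} {x : V} :
    IsSingular Q (Submodule.span K (insert x s)) ↔
      IsSingular Q (Submodule.span K s) ∧ x ∈ perp Q (Submodule.span K s) ∧ Q x = 0 := by
  rw [Submodule.span_insert]
  constructor
  · intro h
    have hx : x ∈ Submodule.span K {x} ⊔ Submodule.span K s :=
      Submodule.mem_sup_left (Submodule.mem_span_singleton_self x)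
    exact ⟨h.mono le_sup_right, perp_anti le_sup_right (h.le_perp hx), h x hx⟩
  · rintro ⟨h, hx, h0⟩
    exact (isSingular_span_singleton h0).sup h ((Submodule.span_singleton_le_iff_mem _ _).2 hx)

variable [Fintype V]

/-- The linearly independent `k`-tuples spanning a singular subspace. -/
def singularFrames (Q : QuadraticForm K V) (k : ℕ) : Finset (Fin k → V) :=
  univ.filter fun s => LinearIndependent K s ∧ IsSingular Q (Submodule.span K (Set.range s))

theorem mem_singularFrames {k : ℕ} {s : Fin k → V} : s ∈ singularFrames Q k ↔
    LinearIndependent K s ∧ IsSingular Q (Submodule.span K (Set.range s)) := by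
  simp [singularFrames]

/-- A longer frame is a frame with one vector prepended, and the number of admissible vectors
depends only on the dimension of the span. -/
theorem card_singularFrames_succ {k c : ℕ} (hc : ∀ U : Submodule K V, IsSingular Q U →
      finrank K U = k → (univ.filter fun x => (x ∈ perp Q U ∧ Q x = 0) ∧ x ∉ U).card = c) :
    (singularFrames Q (k + 1)).card = (singularFrames Q k).card * c := by
  have h1 : (singularFrames Q (k + 1)).card =
      (univ.filter fun p : V × (Fin k → V) => p.2 ∈ singularFrames Q k ∧
        (p.1 ∈ perp Q (Submodule.span K (Set.range p.2)) ∧ Q p.1 = 0) ∧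
          p.1 ∉ Submodule.span K (Set.range p.2)).card := by
    symm
    refine Finset.card_equiv (Fin.consEquiv fun _ => V) ?_
    rintro ⟨x, s⟩
    simp only [Finset.mem_filter, Finset.mem_univ, true_and, mem_singularFrames, Fin.consEquiv,
      Equiv.coe_fn_mk, linearIndependent_finCons, Fin.range_cons, isSingular_span_insert]
    tauto
  rw [h1, Finset.card_filter, Fintype.sum_prod_type_right, ← smul_eq_mul, ← Finset.sum_const,
    ← Finset.sum_filter_add_sum_filter_not univ (· ∈ singularFrames Q k)]
  rw [Finset.sum_eq_zero (s := univ.filter fun s => ¬ s ∈ singularFrames Q k), add_zero]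
  · refine Finset.sum_congr (by ext; simp) fun s hs => ?_
    have hs' := mem_singularFrames.1 hs
    rw [← hc _ hs'.2 (by rw [finrank_span_eq_card hs'.1, Fintype.card_fin]), Finset.card_filter]
    exact Finset.sum_congr rfl fun x _ => by simp [hs]
  · intro s hs
    exact Finset.sum_eq_zero fun x _ => by simp [(Finset.mem_filter.1 hs).2]

/-- The singular subspaces of dimension `k`. -/
def singularSubspaces (Q : QuadraticForm K V) (k : ℕ) : Finset (Submodule K V) :=
  letI := Fintype.ofFinite (Submodule K V)
  univ.filter fun L => IsSingular Q L ∧ finrank K L = k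

theorem mem_singularSubspaces {k : ℕ} {L : Submodule K V} :
    L ∈ singularSubspaces Q k ↔ IsSingular Q L ∧ finrank K L = k := by
  simp [singularSubspaces]

variable [Fintype K]
local notation "q" => Fintype.card K

theorem IsHyperbolic.card_extension (hQ : IsHyperbolic Q m) {U : Submodule K V}
    (hU : IsSingular Q U) {k : ℕ} (hk : finrank K U = k) (hkm : k < m) :
    (univ.filter fun x => (x ∈ perp Q U ∧ Q x = 0) ∧ x ∉ U).card =
      q ^ k * ((q ^ (m - k) - 1) * (q ^ (m - k - 1) + 1)) := by
  have h1 := hQ.card_singular_perp hU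
  have h2 : (univ.filter fun x => (x ∈ perp Q U ∧ Q x = 0)).card =
      q ^ k + (univ.filter fun x => (x ∈ perp Q U ∧ Q x = 0) ∧ x ∉ U).card := by
    rw [← hk, ← card_filter_mem U,
      ← Finset.card_filter_add_card_filter_not
        (s := univ.filter fun x => (x ∈ perp Q U ∧ Q x = 0)) (· ∈ U),
      Finset.filter_filter, Finset.filter_filter]
    congr 2
    ext x
    simp only [Finset.mem_filter, Finset.mem_univ, true_and, and_iff_right_iff_imp]
    exact fun hx => ⟨hU.le_perp hx, hU x hx⟩
  obtain ⟨n, rfl⟩ : ∃ n, m = k + (n + 1) := ⟨m - k - 1, by omega⟩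
  have e1 : k + (n + 1) - k = n + 1 := by omega
  have e2 : 2 * (k + (n + 1)) - k = k + (n + 1) + (n + 1) := by omega
  rw [h2, hk, e2] at h1
  rw [e1, Nat.add_sub_cancel]
  have hq1 : 1 ≤ q ^ (n + 1) := Nat.one_le_pow _ _ Fintype.card_pos
  refine Nat.eq_of_mul_eq_mul_right (Fintype.card_pos (α := K)) ?_
  zify [hq1]
  have h1' := congrArg (Nat.cast (R := ℤ)) h1
  push_cast at h1'
  linear_combination h1'

theorem IsHyperbolic.card_singularFrames (hQ : IsHyperbolic Q m) {k : ℕ} (hk : k ≤ m) :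
    (singularFrames Q k).card =
      ∏ i ∈ Finset.range k, q ^ i * ((q ^ (m - i) - 1) * (q ^ (m - i - 1) + 1)) := by
  induction k with
  | zero =>
    rw [Finset.prod_range_zero, Finset.card_eq_one]
    refine ⟨Fin.elim0, ?_⟩
    ext s
    rw [mem_singularFrames, Finset.mem_singleton]
    refine iff_of_true ⟨linearIndependent_empty_type, ?_⟩ (Subsingleton.elim _ _)
    rw [Set.range_eq_empty, Submodule.span_empty]
    exact isSingular_bot
  | succ k ih =>
    rw [Finset.prod_range_succ, ← ih (by omega)]
    exact card_singularFrames_succ fun U hU hUk => hQ.card_extension hU hUk (by omega)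

/-- Frames are grouped by their span; the fibre over a subspace is the set of its ordered bases. -/
theorem card_singularFrames_eq_mul (k : ℕ) :
    (singularFrames Q k).card =
      (singularSubspaces Q k).card * ∏ i ∈ Finset.range k, (q ^ k - q ^ i) := by
  rw [Finset.card_eq_sum_card_fiberwise (f := fun s => Submodule.span K (Set.range s))
    (t := singularSubspaces Q k), ← smul_eq_mul, ← Finset.sum_const]
  · refine Finset.sum_congr rfl fun L hL => ?_
    obtain ⟨hL, hLk⟩ := mem_singularSubspaces.1 hL
    have h1 := card_linearIndependent (K := K) (V := L) hLk.ge
    rw [hLk, Finset.prod_fin_eq_prod_range] at h1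
    rw [Finset.prod_congr rfl (g := fun i => if h : i < k then q ^ k - q ^ i else 1)
      fun i hi => by simp [Finset.mem_range.1 hi], ← h1, Nat.card_eq_fintype_card,
      ← Finset.card_univ]
    symm
    refine Finset.card_bij (fun s _ i => ((s : Fin k → L) i : V)) ?_ ?_ ?_
    · rintro ⟨s, hs⟩ -
      have hs' : LinearIndependent K fun i => (s i : V) := hs.map' L.subtype L.ker_subtype
      have hspan : Submodule.span K (Set.range fun i => (s i : V)) = L := by
        refine Submodule.eq_of_le_of_finrank_eq (Submodule.span_le.2 ?_) ?_
        · rintro _ ⟨i, rfl⟩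
          exact (s i).2
        · rw [finrank_span_eq_card hs', Fintype.card_fin, hLk]
      rw [Finset.mem_filter, mem_singularFrames, hspan]
      exact ⟨⟨hs', hL⟩, rfl⟩
    · rintro ⟨s, hs⟩ - ⟨t, ht⟩ - h
      ext i
      exact congrFun h i
    · intro s hs
      rw [Finset.mem_filter, mem_singularFrames] at hs
      have hmem : ∀ i, s i ∈ L := fun i => by
        rw [← hs.2]; exact Submodule.subset_span ⟨i, rfl⟩
      exact ⟨⟨fun i => ⟨s i, hmem i⟩, LinearIndependent.of_comp L.subtype hs.1.1⟩,
        Finset.mem_univ _, rfl⟩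
  · intro s hs
    obtain ⟨h1, h2⟩ := mem_singularFrames.1 hs
    exact mem_singularSubspaces.2 ⟨h2, by rw [finrank_span_eq_card h1, Fintype.card_fin]⟩

/-- The number of singular subspaces of dimension `m - 1`. -/
theorem IsHyperbolic.card_singularSubspaces (hQ : IsHyperbolic Q m) (hm : 1 ≤ m) :
    ((singularSubspaces Q (m - 1)).card : ℚ) = ((q : ℚ) ^ m - 1) / ((q : ℚ) - 1) *
      ∏ i ∈ Finset.range (m - 1), ((q : ℚ) ^ (m - i - 1) + 1) := by
  obtain ⟨k, rfl⟩ : ∃ k, m = k + 1 := ⟨m - 1, by omega⟩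
  rw [Nat.add_sub_cancel]
  have hq1 : (1 : ℚ) < q := by exact_mod_cast Fintype.one_lt_card
  have key := (card_singularFrames_eq_mul (Q := Q) k).symm.trans
    (hQ.card_singularFrames (Nat.le_succ k))
  have hA : ((∏ i ∈ Finset.range k, (q ^ k - q ^ i) : ℕ) : ℚ) =
      (∏ i ∈ Finset.range k, (q : ℚ) ^ i) * ∏ i ∈ Finset.range k, ((q : ℚ) ^ (k - i) - 1) := by
    rw [← Finset.prod_mul_distrib, Nat.cast_prod]
    refine Finset.prod_congr rfl fun i hi => ?_
    have hik := (Finset.mem_range.1 hi).le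
    rw [Nat.cast_sub (Nat.pow_le_pow_right Fintype.card_pos hik), mul_sub, ← pow_add,
      Nat.add_sub_cancel' hik]
    push_cast; ring
  have hB : ((∏ i ∈ Finset.range k,
        q ^ i * ((q ^ (k + 1 - i) - 1) * (q ^ (k + 1 - i - 1) + 1)) : ℕ) : ℚ) =
      (∏ i ∈ Finset.range k, (q : ℚ) ^ i) * ((∏ i ∈ Finset.range k, ((q : ℚ) ^ (k + 1 - i) - 1)) *
        ∏ i ∈ Finset.range k, ((q : ℚ) ^ (k + 1 - i - 1) + 1)) := by
    rw [← Finset.prod_mul_distrib, ← Finset.prod_mul_distrib, Nat.cast_prod]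
    refine Finset.prod_congr rfl fun i _ => ?_
    push_cast [Nat.cast_sub (Nat.one_le_pow (k + 1 - i) q Fintype.card_pos)]
    ring
  -- The factors run over exponents `2, …, k + 1` on the left and `1, …, k` on the right, so only
  -- the end factors differ.
  have htel : (∏ i ∈ Finset.range k, ((q : ℚ) ^ (k + 1 - i) - 1)) * ((q : ℚ) - 1) =
      (∏ i ∈ Finset.range k, ((q : ℚ) ^ (k - i) - 1)) * ((q : ℚ) ^ (k + 1) - 1) := by
    have h1 := Finset.prod_range_succ (fun i => ((q : ℚ) ^ (k + 1 - i) - 1)) k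
    rw [Finset.prod_range_succ'] at h1
    simpa using h1.symm
  have hP1 : (∏ i ∈ Finset.range k, (q : ℚ) ^ i) ≠ 0 :=
    Finset.prod_ne_zero_iff.2 fun i _ => by positivity
  have hP2 : (∏ i ∈ Finset.range k, ((q : ℚ) ^ (k - i) - 1)) ≠ 0 := by
    refine Finset.prod_ne_zero_iff.2 fun i hi => ?_
    have := one_lt_pow₀ hq1 (n := k - i) (by have := Finset.mem_range.1 hi; omega)
    linarith
  have key' := congrArg (Nat.cast (R := ℚ)) key
  rw [Nat.cast_mul, hA, hB] at key'
  have hq0 : (q : ℚ) - 1 ≠ 0 := by linarith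
  rw [div_mul_eq_mul_div, eq_div_iff hq0]
  refine mul_left_cancel₀ (mul_ne_zero hP1 hP2) ?_
  set P := ∏ i ∈ Finset.range k, ((q : ℚ) ^ (k + 1 - i - 1) + 1)
  set A := ∏ i ∈ Finset.range k, (q : ℚ) ^ i
  linear_combination ((q : ℚ) - 1) * key' + A * P * htel

end SubspaceCount

/-! ### Counting the pairs. -/

section PairCount

variable {K V : Type*} [Field K] [AddCommGroup V] [Module K V] {Q : QuadraticForm K V} {m : ℕ}

theorem cosetDiff_congr {v v' : V} {M L : Submodule K V} (hLM : L ≤ M) (h : v - v' ∈ L) :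
    cosetDiff v M L = cosetDiff v' M L := by
  ext x
  rw [mem_cosetDiff, mem_cosetDiff, ← sub_add_sub_cancel x v v', L.add_mem_iff_left h,
    M.add_mem_iff_left (hLM h)]

/-- The cosets of subspaces determine the subspaces. -/
theorem coset_eq_iff {v v' : V} {L L' : Submodule K V} :
    {x | x - v ∈ L} = {x | x - v' ∈ L'} ↔ L = L' ∧ v - v' ∈ L' := by
  constructor
  · intro h
    have hmem : ∀ x, x - v ∈ L ↔ x - v' ∈ L' := fun x => Set.ext_iff.1 h x
    have hv : v - v' ∈ L' := (hmem v).1 (by simp)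
    refine ⟨?_, hv⟩
    ext x
    rw [← add_sub_cancel_right x v, hmem, add_sub_assoc, L'.add_mem_iff_left hv,
      add_sub_cancel_right]
  · rintro ⟨rfl, h⟩
    ext x
    rw [Set.mem_ofPred_eq, Set.mem_ofPred_eq, ← sub_add_sub_cancel x v v', L.add_mem_iff_left h]

variable [Fintype K]
local notation "q" => Fintype.card K

/-- This recovers `M` as the set of differences of the clique. For `q = 2` it fails: `M \ L` can be
a single coset of `L`, with differences only in `L`. -/
theorem exists_sub_of_mem (hq : q ≠ 2) (v : V) {M L : Submodule K V} (hLM : L < M) {x : V}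
    (hx : x ∈ M) : ∃ y ∈ cosetDiff v M L, ∃ z ∈ cosetDiff v M L, x = y - z := by
  classical
  by_cases hxL : x ∈ L
  · obtain ⟨t, ht, htL⟩ := SetLike.exists_of_lt hLM
    refine ⟨v + (x + t), ⟨?_, ?_⟩, v + t, ⟨?_, ?_⟩, by abel⟩
    · simpa using M.add_mem hx ht
    · simpa [L.add_mem_iff_right hxL] using htL
    · simpa using ht
    · simpa using htL
  -- A third scalar makes both `c • x` and `(c + 1) • x` avoid `L`.
  · obtain ⟨c, hc⟩ : ∃ c : K, c ∉ ({0, -1} : Finset K) := by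
      by_contra! h
      have h1 := Finset.card_le_card (show Finset.univ ⊆ ({0, -1} : Finset K) from fun c _ => h c)
      have h2 := Finset.card_le_two (a := (0 : K)) (b := -1)
      have h3 : 1 < q := Fintype.one_lt_card
      rw [Finset.card_univ] at h1
      omega
    simp only [Finset.mem_insert, Finset.mem_singleton, not_or] at hc
    have hc1 : c + 1 ≠ 0 := fun h => hc.2 (eq_neg_of_add_eq_zero_left h)
    refine ⟨v + (c + 1) • x, ⟨?_, ?_⟩, v + c • x, ⟨?_, ?_⟩, ?_⟩
    · rw [add_sub_cancel_left]; exact M.smul_mem _ hx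
    · rwa [add_sub_cancel_left, L.smul_mem_iff hc1]
    · rw [add_sub_cancel_left]; exact M.smul_mem _ hx
    · rwa [add_sub_cancel_left, L.smul_mem_iff hc.1]
    · rw [add_smul, one_smul]; abel

/-- The differences determine `M`, hence the coset `v + M`; what the clique omits from it is `v +
L`. -/
theorem eq_and_sub_mem_of_cosetDiff_eq (hq : q ≠ 2) {v v' : V} {M L M' L' : Submodule K V}
    (hLM : L < M) (hLM' : L' < M') (h : cosetDiff v M L = cosetDiff v' M' L') :
    L = L' ∧ v - v' ∈ L' := by
  have hle {w w' : V} {A B A' B' : Submodule K V} (hAB : B < A)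
      (h : cosetDiff w A B = cosetDiff w' A' B') : A ≤ A' := by
    intro x hx
    obtain ⟨y, hy, z, hz, rfl⟩ := exists_sub_of_mem hq w hAB hx
    rw [h] at hy hz
    simpa using A'.sub_mem hy.1 hz.1
  obtain rfl : M = M' := le_antisymm (hle hLM h) (hle hLM' h.symm)
  have hv : v - v' ∈ M := by
    obtain ⟨t, ht, htL⟩ := SetLike.exists_of_lt hLM
    have h1 : v + t ∈ cosetDiff v M L := ⟨by simpa using ht, by simpa using htL⟩
    have h2 := h1
    rw [h] at h2
    have := M.sub_mem h2.1 h1.1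
    rwa [sub_sub_sub_cancel_left] at this
  refine coset_eq_iff.1 (Set.ext fun x => ?_)
  rw [Set.mem_ofPred_eq, Set.mem_ofPred_eq]
  have hM : x - v ∈ M ↔ x - v' ∈ M := by
    rw [← sub_add_sub_cancel x v v', M.add_mem_iff_left hv]
  have hx := Set.ext_iff.1 h x
  rw [mem_cosetDiff, mem_cosetDiff, ← hM] at hx
  constructor
  · intro hxL
    by_contra hxL'
    exact (hx.2 ⟨hLM.le hxL, hxL'⟩).2 hxL
  · intro hxL
    by_contra hxL'
    exact (hx.1 ⟨hM.2 (hLM'.le hxL), hxL'⟩).2 hxL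

theorem neg_eq_self_of_card_eq_two (hq : q = 2) (x : V) : -x = x := by
  have h1 : (-1 : K) = 1 := eq_one_of_card_eq_two hq (neg_ne_zero.2 one_ne_zero)
  rw [← neg_one_smul K, h1, one_smul]

theorem mem_sup_span_singleton_of_card_eq_two (hq : q = 2) {L : Submodule K V} {x y : V} :
    x ∈ L ⊔ Submodule.span K {y} ↔ x ∈ L ∨ x + y ∈ L := by
  have hyy : y + y = 0 := by
    rw [add_eq_zero_iff_eq_neg, neg_eq_self_of_card_eq_two hq]
  constructor
  · intro h
    obtain ⟨l, hl, z, hz, rfl⟩ := Submodule.mem_sup.1 h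
    obtain ⟨c, rfl⟩ := Submodule.mem_span_singleton.1 hz
    by_cases hc : c = 0
    · left; simpa [hc] using hl
    · right
      rw [eq_one_of_card_eq_two hq hc, one_smul, add_assoc, hyy, add_zero]
      exact hl
  · rintro (h | h)
    · exact Submodule.mem_sup_left h
    · have : x = (x + y) + y := by rw [add_assoc, hyy, add_zero]
      rw [this]
      exact Submodule.add_mem_sup h (Submodule.mem_span_singleton_self y)

variable [Fintype V]

/-- Counting the values of `Φ` when its fibres are the cosets of the subspaces `S L`. -/
theorem ncard_mul_of_fibers {β : Type*} (Λ : Finset (Submodule K V))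
    (Φ : Submodule K V → V → β) (S : Submodule K V → Submodule K V) (r : ℕ)
    (hr : ∀ L ∈ Λ, finrank K (S L) = r)
    (hΦ : ∀ L ∈ Λ, ∀ L' ∈ Λ, ∀ v v', Φ L v = Φ L' v' ↔ L = L' ∧ v - v' ∈ S L') :
    {p | ∃ L ∈ Λ, ∃ v, p = Φ L v}.ncard * q ^ r = Λ.card * Fintype.card V := by
  classical
  set D := Λ ×ˢ (Finset.univ : Finset V) with hD
  have h1 : {p | ∃ L ∈ Λ, ∃ v, p = Φ L v} = ↑(D.image fun x => Φ x.1 x.2) := by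
    ext p
    simp only [Set.mem_ofPred_eq, Finset.coe_image, Set.mem_image, Finset.mem_coe, hD,
      Finset.mem_product, Finset.mem_univ, and_true, Prod.exists]
    constructor
    · rintro ⟨L, hL, v, rfl⟩; exact ⟨L, v, hL, rfl⟩
    · rintro ⟨L, v, hL, rfl⟩; exact ⟨L, hL, v, rfl⟩
  rw [h1, Set.ncard_coe_finset, ← Finset.card_univ (α := V), ← Finset.card_product, ← hD,
    Finset.card_eq_sum_card_image (fun x : Submodule K V × V => Φ x.1 x.2) D, ← smul_eq_mul,
    ← Finset.sum_const]
  refine Finset.sum_congr rfl fun p hp => ?_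
  obtain ⟨⟨L, v⟩, hLv, rfl⟩ := Finset.mem_image.1 hp
  have hL : L ∈ Λ := (Finset.mem_product.1 hLv).1
  rw [← hr L hL, ← card_filter_mem]
  refine Finset.card_bij (fun w _ => (L, w + v)) ?_ ?_ ?_
  · intro w hw
    simp only [Finset.mem_filter, hD, Finset.mem_product, Finset.mem_univ, and_true]
    exact ⟨hL, (hΦ L hL L hL _ _).2 ⟨rfl, by simpa using hw⟩⟩
  · intro w _ w' _ h
    simpa using h
  · rintro ⟨L', v'⟩ h
    simp only [Finset.mem_filter, hD, Finset.mem_product, Finset.mem_univ, and_true] at h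
    obtain ⟨rfl, h2⟩ := (hΦ L' h.1 L hL _ _).1 h.2
    exact ⟨v' - v, by simpa using h2, by simp⟩

/-- The pairs are the values of a map on `(L, v)`, and the exponent on the left is the dimension of
its fibres. They are cosets of `L` if `q ≠ 2`. If `q = 2`, the cliques are `v + e + L` and `v + f +
L`, which translation by `e + f` interchanges, so the fibres are cosets of `L + ⟨e + f⟩`. -/
theorem IsHyperbolic.ncard_isolatedPairs_mul (hQ : IsHyperbolic Q m) (hm : 1 ≤ m) :
    (isolatedPairs (affinePolarGraph Q) (theta1 (affinePolarGraph Q) + 1)).ncard *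
      q ^ (if q = 2 then m else m - 1) = (singularSubspaces Q (m - 1)).card * q ^ (2 * m) := by
  have hex : ∀ L : Submodule K V, ∃ e f : V, L ∈ singularSubspaces Q (m - 1) →
      Q e = 0 ∧ Q f = 0 ∧ polar Q e f = 1 ∧ e ∈ perp Q L ∧ f ∈ perp Q L ∧
      ∀ x, x ∈ perp Q L ↔ ∃ l ∈ L, ∃ a b : K, x = l + a • e + b • f := by
    intro L
    by_cases hL : L ∈ singularSubspaces Q (m - 1)
    · obtain ⟨h1, h2⟩ := mem_singularSubspaces.1 hL
      obtain ⟨e, f, h⟩ := hQ.exists_hyperbolic_pair h1 (by omega)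
      exact ⟨e, f, fun _ => h⟩
    · exact ⟨0, 0, fun h => absurd h hL⟩
  choose e f hef using hex
  have hadj : ∀ L ∈ singularSubspaces Q (m - 1),
      IsAdjacentPair Q m (L ⊔ Submodule.span K {e L}) (L ⊔ Submodule.span K {f L}) ∧
      (L ⊔ Submodule.span K {e L}) ⊓ (L ⊔ Submodule.span K {f L}) = L := by
    intro L hL
    obtain ⟨h1, h2⟩ := mem_singularSubspaces.1 hL
    obtain ⟨he, hf, hp, heL, hfL, -⟩ := hef L hL
    exact hQ.adjacentPair_of_hyperbolic_pair h1 (by omega) he hf hp heL hfL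
  set Φ : Submodule K V → V → Sym2 (Set V) := fun L v =>
    s(cosetDiff v (L ⊔ Submodule.span K {e L}) L, cosetDiff v (L ⊔ Submodule.span K {f L}) L)
    with hΦ
  have hset : isolatedPairs (affinePolarGraph Q) (theta1 (affinePolarGraph Q) + 1) =
      {p | ∃ L ∈ singularSubspaces Q (m - 1), ∃ v, p = Φ L v} := by
    ext p
    rw [hQ.mem_isolatedPairs_iff hm, Set.mem_ofPred_eq]
    constructor
    · rintro ⟨v, M, N, h, rfl⟩
      have hrk := h.finrank_inf
      have hL : M ⊓ N ∈ singularSubspaces Q (m - 1) :=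
        mem_singularSubspaces.2 ⟨h.singular_left.mono inf_le_left, by omega⟩
      obtain ⟨he, hf, hp, heL, hfL, hperp⟩ := hef _ hL
      have hor (X : Submodule K V) := hQ.mem_sup_span_or (M := X)
        (h.singular_left.mono inf_le_left) hrk he hf hp heL hfL hperp
      have hne : M ≠ N := by
        rintro rfl
        rw [inf_idem, h.finrank_left] at hrk
        omega
      refine ⟨M ⊓ N, hL, v, ?_⟩
      rcases hor M h.singular_left h.finrank_left inf_le_left with hM | hM <;>
      rcases hor N h.singular_right h.finrank_right inf_le_right with hN | hN
      · exact absurd (hM.trans hN.symm) hne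
      · simp only [hΦ, ← hM, ← hN]
      · simp only [hΦ, ← hM, ← hN, Sym2.eq_swap]
      · exact absurd (hM.trans hN.symm) hne
    · rintro ⟨L, hL, v, rfl⟩
      refine ⟨v, _, _, (hadj L hL).1, ?_⟩
      rw [(hadj L hL).2]
  have heL : ∀ L ∈ singularSubspaces Q (m - 1), e L ∉ L := by
    intro L hL h
    obtain ⟨-, -, hp, -, hfL, -⟩ := hef L hL
    rw [mem_perp.1 hfL _ h] at hp
    exact zero_ne_one hp
  have hfL : ∀ L ∈ singularSubspaces Q (m - 1), f L ∉ L := by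
    intro L hL h
    obtain ⟨-, -, hp, heL, -, -⟩ := hef L hL
    rw [polar_comm, mem_perp.1 heL _ h] at hp
    exact zero_ne_one hp
  have hlt {L : Submodule K V} {x : V} (hx : x ∉ L) : L < L ⊔ Submodule.span K {x} :=
    lt_of_le_of_ne le_sup_left fun h => hx (by
      rw [h]; exact Submodule.mem_sup_right (Submodule.mem_span_singleton_self x))
  rw [hset, ← hQ.finrank_eq, ← Module.card_eq_pow_finrank]
  split_ifs with hq
  · refine ncard_mul_of_fibers _ Φ (fun L => L ⊔ Submodule.span K {e L + f L}) m ?_ ?_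
    · intro L hL
      have hefL : e L + f L ∉ L := by
        intro h
        obtain ⟨he, -, hp, heL, -, -⟩ := hef L hL
        have h1 := mem_perp'.1 heL _ h
        rw [polar_add_right, polar_self, he, hp, smul_zero, zero_add] at h1
        exact one_ne_zero h1
      rw [Submodule.finrank_sup_span_singleton hefL, (mem_singularSubspaces.1 hL).2]
      omega
    · intro L hL L' hL' v v'
      have hneg := neg_eq_self_of_card_eq_two (K := K) (V := V) hq
      have hsub (x y : V) : x - y = x + y := by rw [sub_eq_add_neg, hneg]
      have hee (x : V) : x + x = 0 := by rw [add_eq_zero_iff_eq_neg, hneg]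
      simp only [hΦ, Sym2.eq_iff, cosetDiff_of_card_eq_two hq _ (heL L hL),
        cosetDiff_of_card_eq_two hq _ (hfL L hL), cosetDiff_of_card_eq_two hq _ (heL L' hL'),
        cosetDiff_of_card_eq_two hq _ (hfL L' hL'), coset_eq_iff,
        mem_sup_span_singleton_of_card_eq_two hq]
      constructor
      · rintro (⟨⟨rfl, h⟩, -⟩ | ⟨⟨rfl, h⟩, -⟩)
        · exact ⟨rfl, Or.inl (by simpa using h)⟩
        · refine ⟨rfl, Or.inr ?_⟩
          have : v - v' + (e L + f L) = v + e L - (v' + f L) := by simp only [hsub]; abel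
          rwa [this]
      · rintro ⟨rfl, h | h⟩
        · exact Or.inl ⟨⟨rfl, by simpa using h⟩, rfl, by simpa using h⟩
        · have h1 : v + e L - (v' + f L) = v - v' + (e L + f L) := by simp only [hsub]; abel
          have h2 : v + f L - (v' + e L) = v - v' + (e L + f L) := by simp only [hsub]; abel
          exact Or.inr ⟨⟨rfl, by rwa [h1]⟩, rfl, by rwa [h2]⟩
  · refine ncard_mul_of_fibers _ Φ id (m - 1) (fun L hL => (mem_singularSubspaces.1 hL).2) ?_
    intro L hL L' hL' v v'
    simp only [hΦ, Sym2.eq_iff, id]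
    constructor
    · rintro (⟨h, -⟩ | ⟨h, -⟩)
      · exact eq_and_sub_mem_of_cosetDiff_eq hq (hlt (heL L hL)) (hlt (heL L' hL')) h
      -- Even a swapped match gives `L = L'` and `v - v' ∈ L'`, since the comparison does not use
      -- which maximal subspace carries the clique.
      · exact eq_and_sub_mem_of_cosetDiff_eq hq (hlt (heL L hL)) (hlt (hfL L' hL')) h
    · rintro ⟨rfl, h⟩
      exact Or.inl ⟨cosetDiff_congr le_sup_left h, cosetDiff_congr le_sup_left h⟩

end PairCount

end AffinePolar

end

/-! ### The classification and the two counts combined. -/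

theorem mainTheorem4 {K V : Type*} [Field K] [Fintype K] [AddCommGroup V] [Module K V]
    [Fintype V] (m q : ℕ) (hm : 1 ≤ m) (hq : q = Fintype.card K)
    (Q : QuadraticForm K V) (hQ : AffinePolar.IsHyperbolic Q m) :
    AffinePolar.isolatedPairs (AffinePolar.affinePolarGraph Q)
        (AffinePolar.theta1 (AffinePolar.affinePolarGraph Q) + 1) =
      {p | ∃ (v : V) (L : Submodule K V), AffinePolar.IsSingular Q L ∧
        AffinePolar.projDim L = (m : ℤ) - 2 ∧ p ∈ AffinePolar.vDeltaTranslate Q m v L} ∧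
    (q ≠ 2 →
      ((AffinePolar.isolatedPairs (AffinePolar.affinePolarGraph Q)
          (AffinePolar.theta1 (AffinePolar.affinePolarGraph Q) + 1)).ncard : ℚ) =
        (q : ℚ) ^ (m + 1) * (((q : ℚ) ^ m - 1) / ((q : ℚ) - 1)) *
          ∏ i ∈ Finset.range (m - 1), ((q : ℚ) ^ (m - i - 1) + 1)) ∧
    (q = 2 →
      ((AffinePolar.isolatedPairs (AffinePolar.affinePolarGraph Q)
          (AffinePolar.theta1 (AffinePolar.affinePolarGraph Q) + 1)).ncard : ℚ) =
        (2 : ℚ) ^ m * ((2 : ℚ) ^ m - 1) *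
          ∏ i ∈ Finset.range (m - 1), ((2 : ℚ) ^ (m - i - 1) + 1)) := by
  subst hq
  have hcard := hQ.ncard_isolatedPairs_mul hm
  have hsub := hQ.card_singularSubspaces hm
  have hpow : (Fintype.card K : ℚ) ^ (2 * m) =
      (Fintype.card K : ℚ) ^ (m + 1) * (Fintype.card K : ℚ) ^ (m - 1) := by
    rw [← pow_add]; congr 1; omega
  have hq0 : (Fintype.card K : ℚ) ≠ 0 := by simp
  refine ⟨?_, fun hq => ?_, fun hq => ?_⟩
  · ext p
    rw [hQ.mem_isolatedPairs_iff hm, Set.mem_ofPred_eq, AffinePolar.exists_mem_vDeltaTranslate_iff]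
  · rw [if_neg hq] at hcard
    have h := congrArg (Nat.cast (R := ℚ)) hcard
    push_cast at h
    rw [hpow, ← mul_assoc] at h
    rw [mul_right_cancel₀ (pow_ne_zero _ hq0) h, hsub]
    ring
  · rw [if_pos hq] at hcard
    have h := congrArg (Nat.cast (R := ℚ)) hcard
    push_cast at h
    -- Cancelling `q^m` instead of `q^(m-1)` leaves `q^m` instead of `q^(m+1)`, which is the factor
    -- one half; the denominator `q - 1` is 1.
    rw [two_mul, pow_add, ← mul_assoc] at h
    rw [mul_right_cancel₀ (pow_ne_zero _ hq0) h, hsub, hq]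
    push_cast
    ring
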